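/- Let $N\ge 1$ be an integer and let $k\ge 2$ be an even integer. Let $\mathrm{SL}_2(\mathbb Z)$ act on row vectors $(x,y)\in(\mathbb Z/N\mathbb Z)^2$ by right multiplication. For $f:(\mathbb Z/N\mathbb Z)^2\to\mathbb C$ put $$\widehat f(n,m)=\frac1N\sum_{(a,b)\in(\mathbb Z/N\mathbb Z)^2} f(a,b)\,e^{\frac{2\pi i}{N}(am-bn)},\qquad E_{k,f}(z)=\sum_{(c,d)\in\mathbb Z^2\setminus\{(0,0)\}} f(c,d)\,(cz+d)^{-k}\quad(\operatorname{Im} z>0),$$ where for $k=2$ the sum is taken by Eisenstein summation (for each $c\in\mathbb Z$ first over $d$, then over $c$), and $$\mathcal Eis_k(f)=\frac{(k-1)!}{(-2i\pi)^k}\,N^{k-1}E_{k,\widehat f}.$$ Let $\mathcal E_{k,\Gamma_0(N)}(\mathbb C)$ be the image under $\mathcal Eis_k$ of the space of $\Gamma_0(N)$-invariant functions $f:(\mathbb Z/N\mathbb Z)^2\to\mathbb C$, with the additional condition $f(0,0)=0$ if $k=2$. For $d\mid N$, $g=\gcd(d,N/d)$, $q_1=N/g$, $q_2=(N/d)/g$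 (so that $\gcd(N/q_1,q_1/q_2)=g$) and $u\in(\mathbb Z/g\mathbb Z)^*$, let $[q_1,q_2,u]$ be the set of all $(x,y)\in(\mathbb Z/N\mathbb Z)^2$ such that $$\gcd(x,N)=q_1,\qquad \gcd(y,q_1)=q_2,\qquad \frac{x}{q_1}\cdot\frac{y}{q_2}\equiv u \bmod g .$$ Each of these sets is a single $\Gamma_0(N)$-orbit. Let $\mathcal V_{\Gamma_0(N)}$ be the set of the indicator functions of the orbits $[q_1,q_2,u]$ obtained in this way, for all $d\mid N$ and all $u\in(\mathbb Z/\gcd(d,N/d)\mathbb Z)^*$. Then the functions $\mathcal Eis_k(f)$, for $f\in\mathcal V_{\Gamma_0(N)}$ if $k>2$, respectively for $f\in\mathcal V_{\Gamma_0(N)}\setminus\{\mathbf 1_{\{(0,0)\}}\}$ if $k=2$, are linearly independent over $\mathbb C$ and span $\mathcal E_{k,\Gamma_0(N)}(\mathbb C)$; that is, they form a basis of it. -/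

import Mathlib

open scoped UpperHalfPlane Matrix MatrixGroups

noncomputable section

/-- Row vectors `(x, y)` in `(ℤ/Nℤ)²`. -/
abbrev ZVec (N : ℕ) : Type := Fin 2 → ZMod N

/-- The right action of `SL₂(ℤ)` on row vectors modulo `N`: `(x, y) ↦ (x, y) γ`. -/
def rowAct {N : ℕ} (v : ZVec N) (γ : SL(2, ℤ)) : ZVec N :=
  v ᵥ* ((γ : Matrix (Fin 2) (Fin 2) ℤ).map (Int.cast : ℤ → ZMod N))

/-- The orbit of `v` under a subgroup `Γ` of `SL₂(ℤ)`. -/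
def rowOrbit {N : ℕ} (Γ : Subgroup SL(2, ℤ)) (v : ZVec N) : Set (ZVec N) :=
  {w | ∃ γ ∈ Γ, w = rowAct v γ}

/-- The space of functions `f : (ℤ/Nℤ)² → ℂ` invariant under `Γ`, for the action
`(f ∣ γ)(x, y) = f ((x, y) γ⁻¹)`. -/
def invariantFunctions (N : ℕ) (Γ : Subgroup SL(2, ℤ)) : Submodule ℂ (ZVec N → ℂ) where
  carrier := {f | ∀ γ ∈ Γ, ∀ v, f (rowAct v γ⁻¹) = f v}
  add_mem' := fun hf hg γ hγ v => by simp [hf γ hγ v, hg γ hγ v]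
  zero_mem' := fun _ _ _ => rfl
  smul_mem' := fun c f hf γ hγ v => by simp [hf γ hγ v]

/-- The subspace of the functions in `F` that satisfy `f (0, 0) = 0` when `k = 2`. -/
def hypSubspace {N : ℕ} (k : ℕ) (F : Submodule ℂ (ZVec N → ℂ)) :
    Submodule ℂ (ZVec N → ℂ) where
  carrier := {f | f ∈ F ∧ (k = 2 → f 0 = 0)}
  add_mem' := fun hf hg => ⟨F.add_mem hf.1 hg.1, fun h => by simp [hf.2 h, hg.2 h]⟩
  zero_mem' := ⟨F.zero_mem, fun _ => rfl⟩
  smul_mem' := fun c f hf => ⟨F.smul_mem c hf.1, fun h => by simp [hf.2 h]⟩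

/-- The Fourier transform
`f̂ (n, m) = (1/N) ∑_{(a, b)} f (a, b) exp ((2πi/N) (a m - b n))`
(`ZMod.stdAddChar j` is `exp (2πi j / N)`). -/
def fourierTransform {N : ℕ} [NeZero N] (f : ZVec N → ℂ) : ZVec N → ℂ := fun w =>
  (1 / (N : ℂ)) * ∑ v : ZVec N, f v * ZMod.stdAddChar (v 0 * w 1 - v 1 * w 0)

/-- The term of index `(c, d)` of the Eisenstein series: `f (c, d) (c z + d)⁻ᵏ`,
and `0` for `(c, d) = (0, 0)`, which is left out of the sum. -/
def eisTerm {N : ℕ} (k : ℕ) (f : ZVec N → ℂ) (z : ℍ) (c d : ℤ) : ℂ :=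
  if c = 0 ∧ d = 0 then 0
  else f ![(c : ZMod N), (d : ZMod N)] / ((c : ℂ) * (z : ℂ) + (d : ℂ)) ^ k

/-- The Eisenstein series `E_{k,f}`: the (absolutely convergent) sum over all
`(c, d) ≠ (0, 0)` for `k > 2`, and Eisenstein summation (first over `d`, then over `c`)
for `k = 2`. -/
def eisensteinE {N : ℕ} (k : ℕ) (f : ZVec N → ℂ) (z : ℍ) : ℂ :=
  if k = 2 then ∑' c : ℤ, ∑' d : ℤ, eisTerm k f z c d
  else ∑' p : ℤ × ℤ, eisTerm k f z p.1 p.2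

/-- `Eis_k (f) = ((k-1)! / (-2iπ)ᵏ) N^{k-1} E_{k, f̂}`. -/
def eisMap {N : ℕ} [NeZero N] (k : ℕ) (f : ZVec N → ℂ) : ℍ → ℂ := fun z =>
  (((k - 1).factorial : ℂ) / (-2 * Complex.I * (Real.pi : ℂ)) ^ k) * (N : ℂ) ^ (k - 1)
    * eisensteinE k (fourierTransform f) z

/-- The Eisenstein space `E_{k,Γ}(ℂ)`: the image under `Eis_k` of the `Γ`-invariant functions
(with `f (0, 0) = 0` if `k = 2`). -/
def eisensteinSpace (N k : ℕ) [NeZero N] (Γ : Subgroup SL(2, ℤ)) : Set (ℍ → ℂ) :=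
  eisMap k '' (hypSubspace k (invariantFunctions N Γ) : Set (ZVec N → ℂ))

/-- The set `[q₁, q₂, u]` of all `(x, y)` in `(ℤ/Nℤ)²` with `gcd(x, N) = q₁`, `gcd(y, q₁) = q₂`
and `(x/q₁) (y/q₂) ≡ u` modulo `m`; it is used for `m = gcd(N/q₁, q₁/q₂)`. -/
def tripleOrbit (N q₁ q₂ : ℕ) {m : ℕ} (u : (ZMod m)ˣ) : Set (ZVec N) :=
  {v | Nat.gcd (v 0).val N = q₁ ∧ Nat.gcd (v 1).val q₁ = q₂ ∧
    ((((v 0).val / q₁) * ((v 1).val / q₂) : ℕ) : ZMod m) = (u : ZMod m)}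

/-- The triple `[N / g, (N/d) / g, u]` with `g = gcd(d, N/d)` and `u ∈ (ℤ/gℤ)ˣ`. -/
def cuspOrbit (N d : ℕ) (u : (ZMod (Nat.gcd d (N / d)))ˣ) : Set (ZVec N) :=
  tripleOrbit N (N / Nat.gcd d (N / d)) ((N / d) / Nat.gcd d (N / d)) u

/-- For `q₁ = N / g` and `q₂ = (N/d) / g`, the modulus `gcd(N/q₁, q₁/q₂)` of the general triples
`[q₁, q₂, u]` is `g = gcd(d, N/d)`. -/
theorem cuspOrbit_modulus (N d : ℕ) [NeZero N] (hd : d ∣ N) :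
    Nat.gcd (N / (N / Nat.gcd d (N / d)))
      ((N / Nat.gcd d (N / d)) / ((N / d) / Nat.gcd d (N / d))) = Nat.gcd d (N / d) := by
  obtain ⟨e, rfl⟩ := hd
  have hN : d * e ≠ 0 := NeZero.ne _
  have hd0 : 0 < d := Nat.pos_of_ne_zero (left_ne_zero_of_mul hN)
  have he0 : 0 < e := Nat.pos_of_ne_zero (right_ne_zero_of_mul hN)
  rw [Nat.mul_div_cancel_left e hd0]
  have hg : Nat.gcd d e ∣ e := Nat.gcd_dvd_right d e
  have h1 : d * e / (d * e / Nat.gcd d e) = Nat.gcd d e :=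
    Nat.div_div_self (hg.mul_left d) hN
  have hq : 0 < e / Nat.gcd d e := Nat.div_pos (Nat.le_of_dvd he0 hg) (Nat.gcd_pos_of_pos_left e hd0)
  rw [h1, Nat.mul_div_assoc d hg, Nat.mul_div_cancel d hq]
  exact Nat.gcd_eq_left (Nat.gcd_dvd_left d e)

/-- The indicator function of a subset of `(ℤ/Nℤ)²`. -/
def indicatorFun {N : ℕ} (X : Set (ZVec N)) : ZVec N → ℂ := X.indicator fun _ => 1

/-- The set of the indicator functions of the orbits `[N / g, (N/d) / g, u]`, for `d ∣ N`,
`g = gcd(d, N/d)` and `u ∈ (ℤ/gℤ)ˣ`. -/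
def orbitIndicators (N : ℕ) : Set (ZVec N → ℂ) :=
  {f | ∃ d : ℕ, d ∣ N ∧ ∃ u : (ZMod (Nat.gcd d (N / d)))ˣ, f = indicatorFun (cuspOrbit N d u)}

/-- The indicator functions above, without that of the orbit of `(0, 0)` when `k = 2`. -/
def basisFunctions (N k : ℕ) : Set (ZVec N → ℂ) :=
  {f | f ∈ orbitIndicators N ∧ (k = 2 → f ≠ indicatorFun {0})}

end

open Filter Topology

/-! Spanning rests on distribution relations. If g is supported on multiples of a prime p ∣ N, then
p^k Eis_k(v ↦ g(pv)) = p² Eis_k(g) (`satisfiesDistribution_eisLinear`). Every vector has a type N =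
ABD: x = BDs and y = Dt with s prime to A and t prime to B. Inside a type, the Γ₀(N)-orbit is given
by st mod gcd(A,B). The orbits of the theorem are those whose type has A ∣ B and B/A prime to D. The
relations carry all other types to these by two inductions: `TypeMapsTo.of_contract` lowers A until
A ∣ B, and `TypeMapsTo.of_dilate` lowers D until B/A is prime to D.

Independence is a dimension count. The orbits of type (d, N/d, 1) consist of vectors of exact order
N and carry the same indices (d,u) as the orbits of the theorem. An even F supported on such vectors
is determined by E_{k,F}: as z → -d₀/c₀ vertically, y^k E_{k,F} tends to a nonzero multiple of
∑_{j≠0} F(jc₀, jd₀) j^{-k}, and where |F| is largest the terms j = ±1 outweigh the rest because ζ(2)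
- 1 < 1 (`eq_zero_of_eisensteinE_eq_zero`). The span thus contains as many independent functions as
there are indices, so the spanning family is independent.

For k = 2 the two factors in the relations agree, so the relations also hold for f ↦ Eis_2(f) - f(0)
Eis_2(𝟏_{(0,0)}). This map kills the excluded indicator and equals Eis_2 on functions vanishing at
0. -/

/-! ### Convergence and bounds for Eisenstein series -/

theorem sum_pow_mul_exp_le (k : ℕ) {t : ℝ} (ht : 0 < t) :
    ∑' n : ℕ, (n : ℝ) ^ (k + 1) * Real.exp (-t) ^ n ≤
      ((k + 1).factorial * (k + 2).factorial * Real.exp 1) / t ^ (k + 2) := by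
  set x := Real.exp (-t) with hx
  have hx0 : 0 < x := Real.exp_pos _
  have hx1 : x < 1 := by rw [hx]; exact Real.exp_lt_one_iff.2 (by linarith)
  have hnorm : ‖x‖ < 1 := by rwa [Real.norm_of_nonneg hx0.le]
  have hs := summable_pow_mul_geometric_of_norm_lt_one (k + 1) hnorm
  have hs2 := summable_choose_mul_geometric_of_norm_lt_one (k + 1) hnorm
  rw [hs.tsum_eq_zero_add]
  have hle : ∑' n : ℕ, ((n + 1 : ℕ) : ℝ) ^ (k + 1) * x ^ (n + 1) ≤
      ∑' n : ℕ, (k + 1).factorial * x * (((n + (k + 1)).choose (k + 1) : ℝ) * x ^ n) := by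
    refine Summable.tsum_le_tsum (fun n => ?_) ((summable_nat_add_iff 1).2 hs)
      (hs2.mul_left _)
    -- The power is at most the rising factorial (n+1)⋯(n+k+1), and the binomial series then sums in
    -- closed form.
    have h1 : (n + 1) ^ (k + 1) ≤ (k + 1).factorial * (n + (k + 1)).choose (k + 1) := by
      rw [← Nat.ascFactorial_eq_factorial_mul_choose]
      have := Nat.pow_succ_le_ascFactorial (n + 1) (k + 1)
      convert this using 2
    have h2 : ((n + 1 : ℕ) : ℝ) ^ (k + 1) ≤
        (k + 1).factorial * ((n + (k + 1)).choose (k + 1) : ℝ) := by exact_mod_cast h1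
    calc ((n + 1 : ℕ) : ℝ) ^ (k + 1) * x ^ (n + 1)
        ≤ ((k + 1).factorial * ((n + (k + 1)).choose (k + 1) : ℝ)) * x ^ (n + 1) := by gcongr
      _ = _ := by ring
  rw [tsum_mul_left, tsum_choose_mul_geometric_of_norm_lt_one _ hnorm] at hle
  have h1x : t / (1 + t) ≤ 1 - x := by
    have h3 : x * (1 + t) ≤ 1 := by
      have : 1 + t ≤ Real.exp t := by linarith [Real.add_one_le_exp t]
      calc x * (1 + t) ≤ x * Real.exp t := by gcongr
        _ = 1 := by rw [hx, ← Real.exp_add]; simp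
    rw [div_le_iff₀ (by linarith)]
    nlinarith
  -- One term of the exponential series bounds (1+t)^(k+2) by (k+2)! e^(1+t), and x = e^(-t) cancels
  -- all but the factor e.
  have h4 : x * (1 + t) ^ (k + 2) ≤ Real.exp 1 * (k + 2).factorial := by
    have := Real.pow_div_factorial_le_exp (1 + t) (by linarith) (k + 2)
    rw [div_le_iff₀ (by positivity)] at this
    calc x * (1 + t) ^ (k + 2) ≤ x * (Real.exp (1 + t) * (k + 2).factorial) := by gcongr
      _ = _ := by rw [hx, Real.exp_add, Real.exp_neg]; field_simp
  have h5 : x * (1 / (1 - x) ^ (k + 1 + 1)) ≤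
      (Real.exp 1 * (k + 2).factorial) / t ^ (k + 2) := by
    have h6 : (t / (1 + t)) ^ (k + 2) ≤ (1 - x) ^ (k + 2) := by gcongr
    rw [le_div_iff₀ (by positivity)]
    calc x * (1 / (1 - x) ^ (k + 1 + 1)) * t ^ (k + 2)
        ≤ x * (1 / (t / (1 + t)) ^ (k + 2)) * t ^ (k + 2) := by gcongr
      _ = x * (1 + t) ^ (k + 2) := by rw [div_pow]; field_simp
      _ ≤ _ := h4
  have h0 : ((0 : ℕ) : ℝ) ^ (k + 1) * x ^ 0 = 0 := by simp
  rw [h0, zero_add]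
  refine hle.trans ?_
  calc _ = (k + 1).factorial * (x * (1 / (1 - x) ^ (k + 1 + 1))) := by ring
    _ ≤ (k + 1).factorial * ((Real.exp 1 * (k + 2).factorial) / t ^ (k + 2)) := by gcongr
    _ = _ := by ring

/-- Lipschitz's formula turns the sum into a q-series with terms n^(k-1) qⁿ. The point is a decay in
Im τ valid at all heights: it controls both large c and the approach to a cusp, even for k = 2,
where absolute convergence of the double series is not available. -/
theorem exists_norm_tsum_inv_pow_le {k : ℕ} (hk : 2 ≤ k) :
    ∃ C : ℝ, 0 ≤ C ∧ ∀ τ : ℍ, ‖∑' m : ℤ, 1 / ((τ : ℂ) + m) ^ k‖ ≤ C / τ.im ^ k := by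
  obtain ⟨k, rfl⟩ := Nat.exists_eq_add_of_le' hk
  refine ⟨(2 * Real.pi) ^ (k + 2) / (k + 1).factorial *
    (((k + 1).factorial * (k + 2).factorial * Real.exp 1) / (2 * Real.pi) ^ (k + 2)),
    by positivity, fun τ => ?_⟩
  rw [EisensteinSeries.qExpansion_identity (k := k + 1) (by omega) τ, norm_mul]
  have him := τ.im_pos
  have hpi := Real.pi_pos
  have hq : ‖Complex.exp (2 * Real.pi * Complex.I * τ)‖ =
      Real.exp (-(2 * Real.pi * τ.im)) := by
    rw [Complex.norm_exp]; congr 1; simp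
  have hterm : ∀ n : ℕ, ‖(n : ℂ) ^ (k + 1) * Complex.exp (2 * Real.pi * Complex.I * τ) ^ n‖ =
      (n : ℝ) ^ (k + 1) * Real.exp (-(2 * Real.pi * τ.im)) ^ n := by
    intro n; rw [norm_mul, norm_pow, norm_pow, hq]; simp
  have hnorm : ‖Real.exp (-(2 * Real.pi * τ.im))‖ < 1 := by
    rw [Real.norm_of_nonneg (Real.exp_pos _).le]
    exact Real.exp_lt_one_iff.2 (by have := mul_pos (mul_pos two_pos hpi) him; linarith)
  have hs := summable_pow_mul_geometric_of_norm_lt_one (k + 1) hnorm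
  have h1 : ‖∑' n : ℕ, (n : ℂ) ^ (k + 1) * Complex.exp (2 * Real.pi * Complex.I * τ) ^ n‖ ≤
      ∑' n : ℕ, (n : ℝ) ^ (k + 1) * Real.exp (-(2 * Real.pi * τ.im)) ^ n := by
    refine (norm_tsum_le_tsum_norm ?_).trans_eq (tsum_congr hterm)
    simpa only [hterm] using hs
  have h2 := h1.trans (sum_pow_mul_exp_le k (t := 2 * Real.pi * τ.im) (by positivity))
  have h3 : ‖(-2 * (Real.pi : ℂ) * Complex.I) ^ (k + 1 + 1) / ((k + 1).factorial : ℂ)‖ =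
      (2 * Real.pi) ^ (k + 2) / (k + 1).factorial := by
    simp [abs_of_pos hpi]
  rw [h3, mul_div_assoc]
  gcongr
  refine h2.trans_eq ?_
  rw [mul_pow (2 * Real.pi) τ.im, div_div]


/-- The inner sum of an Eisenstein series, over `d` for a fixed `c`. -/
noncomputable def eisRow {N : ℕ} (k : ℕ) (F : ZVec N → ℂ) (z : ℍ) (c : ℤ) : ℂ :=
  ∑' d : ℤ, eisTerm k F z c d

theorem exists_norm_le_of_fintype {α : Type*} [Finite α] (F : α → ℂ) :
    ∃ M : ℝ, 0 ≤ M ∧ ∀ v, ‖F v‖ ≤ M := by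
  have := Fintype.ofFinite α
  exact ⟨∑ v, ‖F v‖, Finset.sum_nonneg fun _ _ => norm_nonneg _, fun v =>
    Finset.single_le_sum (f := fun v => ‖F v‖) (fun _ _ => norm_nonneg _) (Finset.mem_univ v)⟩

theorem norm_eisTerm_le {N k : ℕ} (F : ZVec N → ℂ) {M : ℝ} (hM0 : 0 ≤ M) (hM : ∀ v, ‖F v‖ ≤ M)
    (z : ℍ) (c d : ℤ) : ‖eisTerm k F z c d‖ ≤ M * ‖(((c : ℂ) * z + d) ^ k)⁻¹‖ := by
  unfold eisTerm
  split_ifs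
  · simp only [norm_zero]; positivity
  · rw [div_eq_mul_inv, norm_mul]; gcongr; exact hM _

theorem summable_eisTerm_row {N k : ℕ} [NeZero N] (hk : 2 ≤ k) (F : ZVec N → ℂ) (z : ℍ) (c : ℤ) :
    Summable fun d : ℤ => eisTerm k F z c d := by
  obtain ⟨M, hM0, hM⟩ := exists_norm_le_of_fintype F
  have := (EisensteinSeries.linear_right_summable (z : ℂ) c (k := k) (by exact_mod_cast hk)).norm
  refine Summable.of_norm_bounded (this.mul_left M) fun d => ?_
  simpa using norm_eisTerm_le F hM0 hM z c d

theorem eisRow_neg {N k : ℕ} (F : ZVec N → ℂ) (z : ℍ) (c : ℤ) :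
    eisRow k F z (-c) = (-1) ^ k * eisRow k (fun v => F (-v)) z c := by
  unfold eisRow
  rw [← tsum_mul_left, ← (Equiv.neg ℤ).tsum_eq]
  refine tsum_congr fun d => ?_
  simp only [eisTerm, Equiv.neg_apply, neg_eq_zero]
  split_ifs
  · simp
  · have h1 : (![((-c : ℤ) : ZMod N), ((-d : ℤ) : ZMod N)] : ZVec N) =
        -![(c : ZMod N), (d : ZMod N)] := by
      ext i; fin_cases i <;> simp
    have h2 : ((-c : ℤ) : ℂ) * (z : ℂ) + ((-d : ℤ) : ℂ) = -((c : ℂ) * z + d) := by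
      push_cast; ring
    rw [h1, h2, neg_pow]
    rcases Nat.even_or_odd k with h | h
    · simp [h.neg_one_pow]
    · simp [h.neg_one_pow, div_neg]

/-- On a residue class d = r + mN the coefficient is constant and cz + d = N(τ + m) with τ = (cz +
r)/N, so the Lipschitz bound applies to each of the N classes. Negative c reduces to positive c by
(c,d) ↦ (-c,-d). -/
theorem exists_norm_eisRow_le {N k : ℕ} [NeZero N] (hk : 2 ≤ k) (M : ℝ) :
    ∃ C : ℝ, 0 ≤ C ∧ ∀ F : ZVec N → ℂ, (∀ v, ‖F v‖ ≤ M) → ∀ (z : ℍ) (c : ℤ), c ≠ 0 →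
      ‖eisRow k F z c‖ ≤ C / (|(c : ℝ)| * z.im) ^ k := by
  obtain ⟨C, hC0, hC⟩ := exists_norm_tsum_inv_pow_le hk
  have hN : (0 : ℝ) < N := by exact_mod_cast Nat.pos_of_ne_zero (NeZero.ne N)
  have key : ∀ F : ZVec N → ℂ, (∀ v, ‖F v‖ ≤ M) → ∀ (z : ℍ) (c : ℤ), 0 < c →
      ‖eisRow k F z c‖ ≤ N * (M * C) / (|(c : ℝ)| * z.im) ^ k := by
    intro F hM z c hc
    have hM0 : 0 ≤ M := (norm_nonneg _).trans (hM 0)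
    have hcR : (0 : ℝ) < c := by exact_mod_cast hc
    have hsum := summable_eisTerm_row hk F z c
    let e : ℤ ≃ Fin N × ℤ := (Int.divModEquiv N).trans (Equiv.prodComm _ _)
    have he : ∀ p : Fin N × ℤ, e.symm p = p.1 + p.2 * N := by
      intro p; simp [e, Int.divModEquiv, add_comm]
    have h1 : eisRow k F z c = ∑ r : Fin N, ∑' m : ℤ, eisTerm k F z c (e.symm (r, m)) := by
      unfold eisRow
      rw [← e.symm.tsum_eq, ← tsum_fintype (L := .unconditional _)]
      exact (e.symm.summable_iff.2 hsum).tsum_prod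
    have h2 : ∀ r : Fin N, ‖∑' m : ℤ, eisTerm k F z c (e.symm (r, m))‖ ≤
        (M * C) / (|(c : ℝ)| * z.im) ^ k := by
      intro r
      have him : 0 < (((c : ℂ) * z + (r : ℕ)) / N).im := by
        have : (((c : ℂ) * z + (r : ℕ)) / N).im = c * z.im / N := by
          rw [Complex.div_natCast_im]; simp
        rw [this]; have := z.im_pos; positivity
      set τ : ℍ := ⟨((c : ℂ) * z + (r : ℕ)) / N, him⟩ with hτ
      have hτc : (τ : ℂ) = ((c : ℂ) * z + (r : ℕ)) / N := rfl
      have hτim : τ.im = c * z.im / N := by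
        rw [← UpperHalfPlane.coe_im, hτc, Complex.div_natCast_im]; simp
      have h3 : ∀ m : ℤ, eisTerm k F z c (e.symm (r, m)) =
          F ![(c : ZMod N), ((r : ℕ) : ZMod N)] / N ^ k * (1 / ((τ : ℂ) + m) ^ k) := by
        intro m
        rw [he]
        have hNC : (N : ℂ) ≠ 0 := by exact_mod_cast NeZero.ne N
        have h4 : (c : ℂ) * z + (((r : ℕ) : ℤ) + m * N : ℤ) = N * (τ + m) := by
          rw [hτc]; push_cast; field_simp; ring
        rw [eisTerm, if_neg (fun h => hc.ne' h.1)]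
        simp only
        rw [h4, mul_pow]
        push_cast
        simp only [CharP.cast_eq_zero, mul_zero, add_zero]
        rw [div_mul_div_comm, mul_one]
      rw [tsum_congr h3, tsum_mul_left, norm_mul, norm_div, norm_pow, Complex.norm_natCast]
      calc _ ≤ M / (N : ℝ) ^ k * (C / τ.im ^ k) := by
            gcongr
            · exact hM _
            · exact hC τ
        _ = _ := by
            rw [hτim, abs_of_pos hcR, div_pow]
            have := z.im_pos
            field_simp
    rw [h1]
    refine (norm_sum_le _ _).trans ((Finset.sum_le_sum fun r _ => h2 r).trans_eq ?_)
    simp [mul_div_assoc]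
  -- The absolute value keeps the constant nonnegative for negative M, when no F qualifies.
  refine ⟨N * (|M| * C), by positivity, fun F hM z c hc => ?_⟩
  have hM0 : 0 ≤ M := (norm_nonneg _).trans (hM 0)
  rw [abs_of_nonneg hM0]
  rcases lt_or_gt_of_ne hc with h | h
  · have := key (fun v => F (-v)) (fun v => hM _) z (-c) (by omega)
    rw [← neg_neg c, eisRow_neg]
    simpa using this
  · exact key F hM z c h

theorem summable_inv_abs_pow {k : ℕ} (hk : 2 ≤ k) :
    Summable fun c : ℤ => (|(c : ℝ)| ^ k)⁻¹ := by
  have h2 : Summable fun c : ℤ => ((c : ℝ) ^ k)⁻¹ := by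
    simpa using (Real.summable_one_div_int_pow (p := k)).2 (by omega)
  simpa using h2.norm

theorem summable_eisRow {N k : ℕ} [NeZero N] (hk : 2 ≤ k) (F : ZVec N → ℂ) (z : ℍ) :
    Summable fun c : ℤ => eisRow k F z c := by
  obtain ⟨M, hM0, hM⟩ := exists_norm_le_of_fintype F
  obtain ⟨C, hC0, hC⟩ := exists_norm_eisRow_le (N := N) hk M
  have hs := (summable_inv_abs_pow hk).mul_left (C / z.im ^ k)
  refine Summable.of_norm_bounded_eventually hs ?_
  filter_upwards [(Set.finite_singleton (0 : ℤ)).compl_mem_cofinite] with c hc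
  refine (hC F hM z c hc).trans_eq ?_
  rw [mul_pow]; field_simp

theorem summable_eisTerm_prod {N k : ℕ} [NeZero N] (hk : 3 ≤ k) (F : ZVec N → ℂ) (z : ℍ) :
    Summable fun p : ℤ × ℤ => eisTerm k F z p.1 p.2 := by
  obtain ⟨M, hM0, hM⟩ := exists_norm_le_of_fintype F
  refine Summable.of_norm_bounded ((summable_prod_eisSummand hk z).norm.mul_left M) fun p => ?_
  simpa [EisensteinSeries.eisSummand] using norm_eisTerm_le F hM0 hM z p.1 p.2

theorem eisensteinE_eq_tsum_eisRow {N k : ℕ} [NeZero N] (hk : 2 ≤ k) (F : ZVec N → ℂ) (z : ℍ) :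
    eisensteinE k F z = ∑' c : ℤ, eisRow k F z c := by
  unfold eisensteinE
  split_ifs with h
  · rfl
  · exact (summable_eisTerm_prod (by omega) F z).tsum_prod

theorem eisRow_add {N k : ℕ} [NeZero N] (hk : 2 ≤ k) (F G : ZVec N → ℂ) (z : ℍ) (c : ℤ) :
    eisRow k (F + G) z c = eisRow k F z c + eisRow k G z c := by
  unfold eisRow
  rw [← (summable_eisTerm_row hk F z c).tsum_add (summable_eisTerm_row hk G z c)]
  refine tsum_congr fun d => ?_
  simp only [eisTerm, Pi.add_apply]
  split_ifs <;> ring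

theorem eisRow_smul {N k : ℕ} (a : ℂ) (F : ZVec N → ℂ) (z : ℍ) (c : ℤ) :
    eisRow k (a • F) z c = a * eisRow k F z c := by
  unfold eisRow
  rw [← tsum_mul_left]
  refine tsum_congr fun d => ?_
  simp only [eisTerm, Pi.smul_apply, smul_eq_mul]
  split_ifs <;> ring

/-- The Eisenstein series as a linear function of its coefficient function. -/
noncomputable def eisensteinELinear {N k : ℕ} [NeZero N] (hk : 2 ≤ k) :
    (ZVec N → ℂ) →ₗ[ℂ] (ℍ → ℂ) where
  toFun F := eisensteinE k F
  map_add' F G := by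
    ext z
    simp only [eisensteinE_eq_tsum_eisRow hk, Pi.add_apply, eisRow_add hk]
    exact (summable_eisRow hk F z).tsum_add (summable_eisRow hk G z)
  map_smul' a F := by
    ext z
    simp only [eisensteinE_eq_tsum_eisRow hk, Pi.smul_apply, eisRow_smul, RingHom.id_apply,
      smul_eq_mul, tsum_mul_left]

/-! ### Limits at the cusps -/

/-- The points `-d₀/c₀ + i/(n+1)`, approaching the cusp `-d₀/c₀` vertically. -/
noncomputable def cuspPoint (c₀ d₀ : ℤ) (n : ℕ) : ℍ :=
  ⟨-(d₀ : ℂ) / c₀ + (1 / ((n : ℝ) + 1) : ℝ) * Complex.I, by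
    have h : (-(d₀ : ℂ) / c₀).im = 0 := by
      rw [← Complex.ofReal_intCast, ← Complex.ofReal_intCast, ← Complex.ofReal_neg,
        ← Complex.ofReal_div, Complex.ofReal_im]
    rw [Complex.add_im, h, Complex.im_ofReal_mul]
    simp only [Complex.I_im, mul_one, zero_add]
    positivity⟩

theorem cuspPoint_coe (c₀ d₀ : ℤ) (n : ℕ) :
    (cuspPoint c₀ d₀ n : ℂ) = (-(d₀ : ℝ) / c₀ : ℝ) + (1 / ((n : ℝ) + 1) : ℝ) * Complex.I := by
  simp [cuspPoint]

theorem cuspPoint_im (c₀ d₀ : ℤ) (n : ℕ) : (cuspPoint c₀ d₀ n).im = 1 / ((n : ℝ) + 1) := by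
  rw [← UpperHalfPlane.coe_im, cuspPoint_coe, Complex.add_im, Complex.ofReal_im,
    Complex.im_ofReal_mul]
  simp

/-- The limit of `y ^ k` times a term of the Eisenstein series at a cusp `-d₀/c₀`. -/
noncomputable def cuspTerm {N : ℕ} (k : ℕ) (F : ZVec N → ℂ) (c₀ d₀ c d : ℤ) : ℂ :=
  if c ≠ 0 ∧ c * d₀ = d * c₀ then F ![(c : ZMod N), (d : ZMod N)] / (c * Complex.I) ^ k else 0

theorem linear_cuspPoint_eq {c₀ d₀ : ℤ} (hc₀ : c₀ ≠ 0) (n : ℕ) (c d : ℤ) :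
    (c : ℂ) * cuspPoint c₀ d₀ n + d =
      (((d * c₀ - c * d₀ : ℤ) : ℝ) / c₀ : ℝ) + (c * (1 / ((n : ℝ) + 1)) : ℝ) * Complex.I := by
  rw [cuspPoint_coe]
  have : (c₀ : ℂ) ≠ 0 := by exact_mod_cast hc₀
  push_cast
  field_simp
  ring

/-- At height y above -d₀/c₀, the number cz + d has real part (dc₀ - cd₀)/c₀ and imaginary part cy.
If the real part vanishes, the factor y^k cancels exactly; otherwise the term stays bounded and y^k
sends it to 0. -/
theorem tendsto_eisTerm_cuspPoint {N k : ℕ} (hk : 2 ≤ k) (F : ZVec N → ℂ) {c₀ d₀ : ℤ}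
    (hc₀ : c₀ ≠ 0) (c d : ℤ) :
    Tendsto (fun n : ℕ => ((1 / ((n : ℝ) + 1) : ℝ) : ℂ) ^ k * eisTerm k F (cuspPoint c₀ d₀ n) c d)
      atTop (𝓝 (cuspTerm k F c₀ d₀ c d)) := by
  have hk0 : k ≠ 0 := by omega
  have hy : Tendsto (fun n : ℕ => ((1 / ((n : ℝ) + 1) : ℝ) : ℂ)) atTop (𝓝 0) := by
    have := (Complex.continuous_ofReal.tendsto 0).comp (tendsto_one_div_add_atTop_nhds_zero_nat
      (𝕜 := ℝ))
    rwa [Complex.ofReal_zero] at this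
  by_cases hcd : c = 0 ∧ d = 0
  · simp [eisTerm, cuspTerm, hcd]
  simp only [eisTerm, if_neg hcd, linear_cuspPoint_eq hc₀]
  by_cases h : c * d₀ = d * c₀
  · have hc : c ≠ 0 := by
      rintro rfl
      refine hcd ⟨rfl, ?_⟩
      simpa [hc₀] using h.symm
    rw [cuspTerm, if_pos ⟨hc, h⟩]
    refine tendsto_const_nhds.congr fun n => ?_
    rw [← h]
    have h1 : ((1 / ((n : ℝ) + 1) : ℝ) : ℂ) ≠ 0 := by
      rw [Complex.ofReal_ne_zero]; positivity
    have hcC : (c : ℂ) * Complex.I ≠ 0 := mul_ne_zero (by exact_mod_cast hc) Complex.I_ne_zero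
    have h2 : ((((c * d₀ - c * d₀ : ℤ) : ℝ) / c₀ : ℝ) : ℂ) +
        (c * (1 / ((n : ℝ) + 1)) : ℝ) * Complex.I =
        ((1 / ((n : ℝ) + 1) : ℝ) : ℂ) * (c * Complex.I) := by
      push_cast; simp; ring
    rw [h2, mul_pow _ ((c : ℂ) * Complex.I)]
    field_simp
  · rw [cuspTerm, if_neg (fun h' => h h'.2)]
    have hne : ((((d * c₀ - c * d₀ : ℤ) : ℝ) / c₀ : ℝ) : ℂ) ≠ 0 := by
      rw [Complex.ofReal_ne_zero]
      refine div_ne_zero ?_ (by exact_mod_cast hc₀)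
      exact_mod_cast fun h' => h (by linarith)
    have hden : Tendsto (fun n : ℕ => ((((d * c₀ - c * d₀ : ℤ) : ℝ) / c₀ : ℝ) : ℂ) +
        (c * (1 / ((n : ℝ) + 1)) : ℝ) * Complex.I) atTop
        (𝓝 ((((d * c₀ - c * d₀ : ℤ) : ℝ) / c₀ : ℝ) : ℂ)) := by
      have := (hy.const_mul ((c : ℂ) * Complex.I)).const_add
        ((((d * c₀ - c * d₀ : ℤ) : ℝ) / c₀ : ℝ) : ℂ)
      rw [mul_zero, add_zero] at this
      refine this.congr fun n => ?_
      push_cast; ring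
    have h1 := (hy.pow k).mul ((tendsto_const_nhds
      (x := F ![(c : ZMod N), (d : ZMod N)])).div (hden.pow k) (pow_ne_zero k hne))
    rw [zero_pow hk0, zero_mul] at h1
    exact h1

/-- Dominated convergence: off the line cd₀ = dc₀ the denominator is at least its real part in
absolute value, which does not depend on y. At most one d lies on that line. -/
theorem tendsto_eisRow_cuspPoint {N k : ℕ} [NeZero N] (hk : 2 ≤ k) (F : ZVec N → ℂ) {c₀ d₀ : ℤ}
    (hc₀ : c₀ ≠ 0) (c : ℤ) :
    Tendsto (fun n : ℕ => ((1 / ((n : ℝ) + 1) : ℝ) : ℂ) ^ k * eisRow k F (cuspPoint c₀ d₀ n) c)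
      atTop (𝓝 (∑' d : ℤ, cuspTerm k F c₀ d₀ c d)) := by
  obtain ⟨M, hM0, hM⟩ := exists_norm_le_of_fintype F
  simp only [eisRow, ← tsum_mul_left]
  set x : ℂ := ((-(d₀ : ℝ) / c₀ : ℝ) : ℂ) with hx
  have hlin : ∀ d : ℤ, (c : ℂ) * x + d = (((d * c₀ - c * d₀ : ℤ) : ℝ) / c₀ : ℝ) := by
    intro d
    have : (c₀ : ℂ) ≠ 0 := by exact_mod_cast hc₀
    rw [hx]; push_cast; field_simp; ring
  have hs1 := (EisensteinSeries.linear_right_summable x c (k := k) (by exact_mod_cast hk)).norm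
  have hs2 : Summable fun d : ℤ => if c * d₀ = d * c₀ then M * ‖((c : ℂ) ^ k)⁻¹‖ else 0 := by
    refine summable_of_hasFiniteSupport (Set.Finite.subset (s := {d | c * d₀ = d * c₀}) ?_ ?_)
    · refine Set.Subsingleton.finite fun a ha b hb => ?_
      exact mul_right_cancel₀ hc₀ (ha.symm.trans hb)
    · intro d hd
      by_contra h
      exact hd (if_neg h)
  refine tendsto_tsum_of_dominated_convergence
    (bound := fun d : ℤ => M * ‖(((c : ℂ) * x + d) ^ (k : ℤ))⁻¹‖ +
      if c * d₀ = d * c₀ then M * ‖((c : ℂ) ^ k)⁻¹‖ else 0)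
    ((hs1.mul_left M).add hs2) (fun d => tendsto_eisTerm_cuspPoint hk F hc₀ c d)
    (Eventually.of_forall fun n d => ?_)
  have hy0 : (0 : ℝ) < 1 / ((n : ℝ) + 1) := by positivity
  have hy1 : 1 / ((n : ℝ) + 1) ≤ 1 := by
    rw [div_le_one (by positivity)]; linarith [n.cast_nonneg (α := ℝ)]
  set y : ℝ := 1 / ((n : ℝ) + 1) with hy
  have hnorm : ‖(y : ℂ) ^ k‖ = y ^ k := by
    rw [norm_pow, Complex.norm_real, Real.norm_of_nonneg hy0.le]
  have hterm := norm_eisTerm_le F hM0 hM (cuspPoint c₀ d₀ n) c d (k := k)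
  rw [norm_mul, hnorm]
  by_cases h : c * d₀ = d * c₀
  · rw [if_pos h]
    have h0 : ‖((c : ℂ) * cuspPoint c₀ d₀ n + d)‖ = y * ‖(c : ℂ)‖ := by
      rw [linear_cuspPoint_eq hc₀, ← h, ← hy]
      simp [abs_of_pos hy0, mul_comm]
    rw [norm_inv, norm_pow, h0] at hterm
    calc y ^ k * ‖eisTerm k F (cuspPoint c₀ d₀ n) c d‖
        ≤ y ^ k * (M * ((y * ‖(c : ℂ)‖) ^ k)⁻¹) := by gcongr
      _ = M * ‖((c : ℂ) ^ k)⁻¹‖ := by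
          rw [norm_inv, norm_pow, mul_pow, mul_inv]; field_simp
      _ ≤ _ := by simp only [le_add_iff_nonneg_left]; positivity
  · rw [if_neg h, add_zero]
    have hpos : 0 < ‖(c : ℂ) * x + d‖ := by
      rw [norm_pos_iff, hlin, Complex.ofReal_ne_zero]
      refine div_ne_zero ?_ (by exact_mod_cast hc₀)
      exact_mod_cast fun h' => h (by linarith)
    have hle : ‖(c : ℂ) * x + d‖ ≤ ‖((c : ℂ) * cuspPoint c₀ d₀ n + d)‖ := by
      rw [linear_cuspPoint_eq hc₀, hlin]
      refine (Complex.norm_real _).trans_le ?_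
      refine le_trans ?_ (Complex.abs_re_le_norm _)
      simp [abs_div]
    calc y ^ k * ‖eisTerm k F (cuspPoint c₀ d₀ n) c d‖
        ≤ 1 * ‖eisTerm k F (cuspPoint c₀ d₀ n) c d‖ := by
          gcongr; exact pow_le_one₀ hy0.le hy1
      _ ≤ M * (‖(c : ℂ) * cuspPoint c₀ d₀ n + d‖ ^ k)⁻¹ := by
          rw [one_mul]; simpa using hterm
      _ ≤ M * (‖(c : ℂ) * x + d‖ ^ k)⁻¹ := by gcongr
      _ = _ := by rw [zpow_natCast, norm_inv, norm_pow]

theorem tendsto_eisensteinE_cuspPoint {N k : ℕ} [NeZero N] (hk : 2 ≤ k) (F : ZVec N → ℂ)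
    {c₀ d₀ : ℤ} (hc₀ : c₀ ≠ 0) :
    Tendsto (fun n : ℕ => ((1 / ((n : ℝ) + 1) : ℝ) : ℂ) ^ k *
      eisensteinE k F (cuspPoint c₀ d₀ n))
      atTop (𝓝 (∑' c : ℤ, ∑' d : ℤ, cuspTerm k F c₀ d₀ c d)) := by
  obtain ⟨M, hM0, hM⟩ := exists_norm_le_of_fintype F
  obtain ⟨C, hC0, hC⟩ := exists_norm_eisRow_le (N := N) hk M
  simp only [eisensteinE_eq_tsum_eisRow hk, ← tsum_mul_left]
  -- The uniform row bound excludes c = 0; that row, scaled by y^k, is bounded because it converges.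
  obtain ⟨B, hB⟩ : ∃ B : ℝ, ∀ n : ℕ, ‖((1 / ((n : ℝ) + 1) : ℝ) : ℂ) ^ k *
      eisRow k F (cuspPoint c₀ d₀ n) 0‖ ≤ B := by
    obtain ⟨B, hB⟩ := (tendsto_eisRow_cuspPoint hk F hc₀ 0 (d₀ := d₀)).norm.bddAbove_range
    exact ⟨B, fun n => hB ⟨n, rfl⟩⟩
  have hs : Summable fun c : ℤ => C * (|(c : ℝ)| ^ k)⁻¹ + if c = 0 then B else 0 := by
    refine ((summable_inv_abs_pow hk).mul_left C).add ?_
    exact summable_of_hasFiniteSupport ((Set.finite_singleton 0).subset fun c hc => by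
      by_contra h; exact hc (if_neg h))
  refine tendsto_tsum_of_dominated_convergence hs
    (fun c => tendsto_eisRow_cuspPoint hk F hc₀ c) (Eventually.of_forall fun n c => ?_)
  by_cases h : c = 0
  · subst h
    refine (hB n).trans ?_
    simp only [if_true, le_add_iff_nonneg_left]
    positivity
  · rw [if_neg h, add_zero, norm_mul, norm_pow, Complex.norm_real]
    have hy0 : (0 : ℝ) < 1 / ((n : ℝ) + 1) := by positivity
    rw [Real.norm_of_nonneg hy0.le]
    have := hC F hM (cuspPoint c₀ d₀ n) c h
    rw [cuspPoint_im] at this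
    calc _ ≤ (1 / ((n : ℝ) + 1)) ^ k * (C / (|(c : ℝ)| * (1 / ((n : ℝ) + 1))) ^ k) := by gcongr
      _ = _ := by rw [mul_pow]; field_simp

theorem tsum_cuspTerm {N : ℕ} {k : ℕ} (hk : 2 ≤ k) (F : ZVec N → ℂ) {c₀ d₀ : ℤ}
    (hc₀ : c₀ ≠ 0) (hcop : IsCoprime c₀ d₀) :
    ∑' c : ℤ, ∑' d : ℤ, cuspTerm k F c₀ d₀ c d =
      ((c₀ * Complex.I) ^ k)⁻¹ *
        ∑' j : ℤ, F ![((j * c₀ : ℤ) : ZMod N), ((j * d₀ : ℤ) : ZMod N)] / (j : ℂ) ^ k := by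
  have hinj : Function.Injective fun j : ℤ => j * c₀ := mul_left_injective₀ hc₀
  rw [← hinj.tsum_eq, ← tsum_mul_left]
  · refine tsum_congr fun j => ?_
    rw [tsum_eq_single (j * d₀)]
    · by_cases hj : j = 0
      -- Both sides vanish: the right one because division by 0 ^ k = 0 gives 0.
      · subst hj; simp [cuspTerm, show k ≠ 0 by omega]
      · rw [cuspTerm, if_pos ⟨mul_ne_zero hj hc₀, by ring⟩]
        push_cast
        rw [mul_assoc (j : ℂ), mul_pow (j : ℂ)]
        have : ((c₀ : ℂ) * Complex.I) ^ k ≠ 0 :=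
          pow_ne_zero _ (mul_ne_zero (by exact_mod_cast hc₀) Complex.I_ne_zero)
        have : (j : ℂ) ≠ 0 := by exact_mod_cast hj
        field_simp
    · intro d hd
      rw [cuspTerm, if_neg]
      rintro ⟨-, h⟩
      exact hd (mul_right_cancel₀ hc₀ (by rw [← h]; ring))
  · intro c hc
    by_contra hr
    refine hc ?_
    simp only
    rw [← tsum_zero]
    refine tsum_congr fun d => ?_
    rw [cuspTerm, if_neg]
    rintro ⟨-, h⟩
    have : c₀ ∣ c := hcop.dvd_of_dvd_mul_right ⟨d, by rw [h]; ring⟩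
    obtain ⟨j, rfl⟩ := this
    exact hr ⟨j, by ring⟩

theorem tsum_eq_zero_of_eisensteinE_eq_zero {N k : ℕ} [NeZero N] (hk : 2 ≤ k) (F : ZVec N → ℂ)
    (hF : eisensteinE k F = 0) {c₀ d₀ : ℤ} (hc₀ : c₀ ≠ 0) (hcop : IsCoprime c₀ d₀) :
    ∑' j : ℤ, F ![((j * c₀ : ℤ) : ZMod N), ((j * d₀ : ℤ) : ZMod N)] / (j : ℂ) ^ k = 0 := by
  have h1 := tendsto_eisensteinE_cuspPoint hk F hc₀ (d₀ := d₀)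
  simp only [hF, Pi.zero_apply, mul_zero] at h1
  have h2 := tendsto_nhds_unique tendsto_const_nhds h1
  rw [tsum_cuspTerm hk F hc₀ hcop] at h2
  refine (mul_eq_zero.1 h2.symm).resolve_left (inv_ne_zero (pow_ne_zero _ ?_))
  exact mul_ne_zero (by exact_mod_cast hc₀) Complex.I_ne_zero

/-! ### Injectivity on even functions supported on vectors of order N -/

/-- Take c = x + N, which is nonzero. With h = gcd(y,N), y = hy' and N = hN', choose T ≡ y' mod N'
prime to N'c, by surjectivity of reduction on units, and put d = hT. A common factor of c and h
divides x, y and N, hence is 1. -/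
theorem exists_isCoprime_lift {N : ℕ} [NeZero N] (v : ZVec N)
    (hv : Nat.gcd (Nat.gcd (v 0).val N) (v 1).val = 1) :
    ∃ c d : ℤ, c ≠ 0 ∧ IsCoprime c d ∧ ![(c : ZMod N), (d : ZMod N)] = v := by
  set x := (v 0).val with hx
  set y := (v 1).val with hy
  have hN : N ≠ 0 := NeZero.ne N
  set c := x + N with hc
  set h := Nat.gcd y N with hh
  have hh0 : 0 < h := Nat.gcd_pos_of_pos_right _ (Nat.pos_of_ne_zero hN)
  obtain ⟨y', hy'⟩ : h ∣ y := Nat.gcd_dvd_left _ _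
  obtain ⟨N', hN'⟩ : h ∣ N := Nat.gcd_dvd_right _ _
  have hcop' : Nat.Coprime y' N' := by
    have := Nat.coprime_div_gcd_div_gcd (m := y) (n := N) hh0
    rwa [← hh, Nat.div_eq_of_eq_mul_right hh0 hy', Nat.div_eq_of_eq_mul_right hh0 hN'] at this
  have hc0 : c ≠ 0 := by omega
  have hN'0 : N' ≠ 0 := by rintro rfl; simp at hN'; exact hN hN'
  have : NeZero (N' * c) := ⟨mul_ne_zero hN'0 hc0⟩
  obtain ⟨t, ht⟩ := ZMod.unitsMap_surjective (Dvd.intro c rfl : N' ∣ N' * c)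
    (ZMod.unitOfCoprime y' hcop')
  have ht1 : ((t : ZMod (N' * c)).val : ZMod N') = (y' : ZMod N') := by
    have := congrArg (fun u : (ZMod N')ˣ => (u : ZMod N')) ht
    rw [ZMod.unitsMap_val, ZMod.coe_unitOfCoprime] at this
    rw [← this, ZMod.natCast_val]
  set T := (t : ZMod (N' * c)).val with hT
  have htc : Nat.Coprime T (N' * c) := ZMod.val_coe_unit_coprime t
  refine ⟨c, (h * T : ℕ), by exact_mod_cast hc0, ?_, ?_⟩
  · rw [Nat.isCoprime_iff_coprime]
    refine Nat.Coprime.mul_right ?_ (htc.coprime_mul_left_right).symm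
    have h1 : Nat.gcd c h ∣ Nat.gcd (Nat.gcd x N) y := by
      have ha : Nat.gcd c h ∣ N := (Nat.gcd_dvd_right _ _).trans (Nat.gcd_dvd_right _ _)
      have hb : Nat.gcd c h ∣ y := (Nat.gcd_dvd_right _ _).trans (Nat.gcd_dvd_left _ _)
      refine Nat.dvd_gcd (Nat.dvd_gcd ?_ ha) hb
      exact (Nat.dvd_add_left ha).1 (Nat.gcd_dvd_left _ _)
    rw [hv] at h1
    exact Nat.dvd_one.1 h1
  · ext i
    fin_cases i
    · simp [hc, hx]
    · have h2 : h * T ≡ y [MOD N] := by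
        rw [hy', hN']
        exact Nat.ModEq.mul_left' h ((ZMod.natCast_eq_natCast_iff _ _ _).1 ht1)
      have h3 := (ZMod.natCast_eq_natCast_iff _ _ _).2 h2
      simp only [Fin.mk_one, Matrix.cons_val_one, Matrix.cons_val_fin_one, Int.cast_natCast]
      rw [h3, hy, ZMod.natCast_zmod_val]

/-- Let v₀ maximize |F|, and lift it to a coprime pair. The vanishing limit at the corresponding
cusp reads ∑ F(jv₀)/j^k = 0. As F and k are even, the sum over j ≥ 1 vanishes too, so |F(v₀)| ≤
(ζ(2) - 1)|F(v₀)|. -/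
theorem eq_zero_of_eisensteinE_eq_zero {N k : ℕ} [NeZero N] (hk : 2 ≤ k) (hke : Even k)
    (F : ZVec N → ℂ) (heven : ∀ v, F (-v) = F v)
    (hsupp : ∀ v, F v ≠ 0 → Nat.gcd (Nat.gcd (v 0).val N) (v 1).val = 1)
    (hF : eisensteinE k F = 0) : F = 0 := by
  by_contra hne
  obtain ⟨v₀, -, hmax⟩ := Finset.exists_max_image Finset.univ (fun v => ‖F v‖)
    ⟨0, Finset.mem_univ _⟩
  have hv0 : F v₀ ≠ 0 := by
    intro h0
    refine hne (funext fun v => ?_)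
    have := hmax v (Finset.mem_univ _)
    rw [h0, norm_zero] at this
    simpa using this
  obtain ⟨c₀, d₀, hc₀, hcop, hv⟩ := exists_isCoprime_lift v₀ (hsupp v₀ hv0)
  have h := tsum_eq_zero_of_eisensteinE_eq_zero hk F hF hc₀ hcop
  set g : ℤ → ℂ := fun j => F ![((j * c₀ : ℤ) : ZMod N), ((j * d₀ : ℤ) : ZMod N)] / (j : ℂ) ^ k
    with hg
  have hbound : ∀ j : ℤ, ‖g j‖ ≤ ‖F v₀‖ * (|(j : ℝ)| ^ k)⁻¹ := by
    intro j
    rw [hg]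
    simp only
    rw [norm_div, norm_pow, Complex.norm_intCast, div_eq_mul_inv]
    gcongr
    exact hmax _ (Finset.mem_univ _)
  have hgs : Summable g := Summable.of_norm_bounded ((summable_inv_abs_pow hk).mul_left _) hbound
  have hg0 : g 0 = 0 := by simp [hg, show k ≠ 0 by omega]
  have hgneg : ∀ j, g (-j) = g j := by
    intro j
    simp only [hg]
    have : (![((-j * c₀ : ℤ) : ZMod N), ((-j * d₀ : ℤ) : ZMod N)] : ZVec N) =
      -![((j * c₀ : ℤ) : ZMod N), ((j * d₀ : ℤ) : ZMod N)] := by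
      ext i; fin_cases i <;> simp
    rw [this, heven, Int.cast_neg, hke.neg_pow]
  have hnat : ∑' n : ℕ, g ((n : ℤ) + 1) = 0 := by
    have h1 := tsum_of_add_one_of_neg_add_one (f := g)
      (hgs.comp_injective (i := fun n : ℕ => (n : ℤ) + 1) (fun a b h => by simpa using h))
      (hgs.comp_injective (i := fun n : ℕ => -((n : ℤ) + 1)) (fun a b h => by simpa using h))
    rw [h, hg0] at h1
    simp only [hgneg, add_zero] at h1
    have h2 : (2 : ℂ) * ∑' n : ℕ, g ((n : ℤ) + 1) = 0 := by rw [two_mul]; exact h1.symm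
    simpa using h2
  have hsn : Summable fun n : ℕ => g ((n : ℤ) + 1) :=
    hgs.comp_injective (i := fun n : ℕ => (n : ℤ) + 1) (fun a b h => by simpa using h)
  rw [hsn.tsum_eq_zero_add] at hnat
  have hg1 : g (((0 : ℕ) : ℤ) + 1) = F v₀ := by
    simp only [hg]; simp [← hv]
  rw [hg1] at hnat
  have hz := hasSum_zeta_two
  have hz1 : ∑' n : ℕ, 1 / (((n + 2 : ℕ)) : ℝ) ^ 2 = Real.pi ^ 2 / 6 - 1 := by
    have := hz.summable.sum_add_tsum_nat_add 2
    rw [hz.tsum_eq] at this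
    simp [Finset.sum_range_succ] at this
    push_cast
    simp only [one_div]
    linarith
  have hz2 : Summable fun n : ℕ => 1 / (((n + 2 : ℕ)) : ℝ) ^ 2 :=
    (summable_nat_add_iff 2).2 hz.summable
  -- Since j ≥ 2 here, j^k ≥ j², and ζ(2) serves for every k.
  have htail : ‖∑' n : ℕ, g (((n + 1 : ℕ) : ℤ) + 1)‖ ≤ ‖F v₀‖ * (Real.pi ^ 2 / 6 - 1) := by
    rw [← hz1, ← tsum_mul_left]
    refine tsum_of_norm_bounded (hz2.mul_left _).hasSum fun n => ?_
    refine (hbound _).trans ?_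
    rw [one_div]
    have h1 : |((((n + 1 : ℕ) : ℤ) + 1 : ℤ) : ℝ)| = ((n + 2 : ℕ) : ℝ) := by
      push_cast
      rw [abs_of_nonneg (by positivity)]; ring
    rw [h1]
    gcongr
    · push_cast; linarith [n.cast_nonneg (α := ℝ)]
  have hF0 : ‖F v₀‖ = ‖∑' n : ℕ, g (((n + 1 : ℕ) : ℤ) + 1)‖ := by
    rw [eq_neg_of_add_eq_zero_left hnat, norm_neg]
  have hpos : 0 < ‖F v₀‖ := norm_pos_iff.2 hv0
  have hpi : Real.pi ^ 2 / 6 - 1 < 1 := by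
    have := Real.pi_lt_d2
    have := Real.pi_pos
    nlinarith
  have := mul_lt_mul_of_pos_left hpi hpos
  linarith

/-! ### The action of SL₂(ℤ) and the Fourier transform -/

theorem rowAct_zero_apply {N : ℕ} (v : ZVec N) (γ : SL(2, ℤ)) :
    rowAct v γ 0 = v 0 * (γ 0 0 : ℤ) + v 1 * (γ 1 0 : ℤ) := by
  simp [rowAct, Matrix.vecMul, dotProduct, Fin.sum_univ_two]

theorem rowAct_one_apply {N : ℕ} (v : ZVec N) (γ : SL(2, ℤ)) :
    rowAct v γ 1 = v 0 * (γ 0 1 : ℤ) + v 1 * (γ 1 1 : ℤ) := by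
  simp [rowAct, Matrix.vecMul, dotProduct, Fin.sum_univ_two]

theorem rowAct_mul {N : ℕ} (v : ZVec N) (γ δ : SL(2, ℤ)) :
    rowAct v (γ * δ) = rowAct (rowAct v γ) δ := by
  simp only [rowAct, Matrix.SpecialLinearGroup.coe_mul, Matrix.vecMul_vecMul]
  congr 1
  exact Matrix.map_mul (f := Int.castRingHom (ZMod N))

theorem rowAct_one {N : ℕ} (v : ZVec N) : rowAct v 1 = v := by
  ext i
  fin_cases i
  · simp [rowAct_zero_apply]
  · simp [rowAct_one_apply]

theorem rowAct_inv_rowAct {N : ℕ} (v : ZVec N) (γ : SL(2, ℤ)) :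
    rowAct (rowAct v γ) γ⁻¹ = v := by
  rw [← rowAct_mul, mul_inv_cancel, rowAct_one]

theorem rowAct_rowAct_inv {N : ℕ} (v : ZVec N) (γ : SL(2, ℤ)) :
    rowAct (rowAct v γ⁻¹) γ = v := by
  rw [← rowAct_mul, inv_mul_cancel, rowAct_one]

theorem rowAct_smul {N : ℕ} (a : ZMod N) (v : ZVec N) (γ : SL(2, ℤ)) :
    rowAct (a • v) γ = a • rowAct v γ := by
  simp [rowAct, Matrix.smul_vecMul]

theorem rowAct_zero {N : ℕ} (γ : SL(2, ℤ)) : rowAct (0 : ZVec N) γ = 0 := by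
  simp [rowAct]

/-- The permutation of `(ℤ/Nℤ)²` given by an element of `SL₂(ℤ)`. -/
def rowActEquiv {N : ℕ} (γ : SL(2, ℤ)) : ZVec N ≃ ZVec N where
  toFun v := rowAct v γ
  invFun v := rowAct v γ⁻¹
  left_inv v := rowAct_inv_rowAct v γ
  right_inv v := rowAct_rowAct_inv v γ

theorem mem_invariantFunctions_iff {N : ℕ} {Γ : Subgroup SL(2, ℤ)} {f : ZVec N → ℂ} :
    f ∈ invariantFunctions N Γ ↔ ∀ γ ∈ Γ, ∀ v, f (rowAct v γ) = f v :=
  ⟨fun h γ hγ v => by simpa using h γ⁻¹ (Γ.inv_mem hγ) v, fun h γ hγ v => h _ (Γ.inv_mem hγ) v⟩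

theorem rowAct_det {N : ℕ} (v w : ZVec N) (γ : SL(2, ℤ)) :
    rowAct v γ 0 * rowAct w γ 1 - rowAct v γ 1 * rowAct w γ 0 = v 0 * w 1 - v 1 * w 0 := by
  have hdet : ((γ 0 0 : ℤ) : ZMod N) * (γ 1 1 : ℤ) - (γ 0 1 : ℤ) * (γ 1 0 : ℤ) = 1 := by
    have := γ.det_coe
    rw [Matrix.det_fin_two] at this
    exact_mod_cast congrArg (Int.cast : ℤ → ZMod N) this
  simp only [rowAct_zero_apply, rowAct_one_apply]
  linear_combination (v 0 * w 1 - v 1 * w 0) * hdet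

/-- The kernel depends only on the determinant of the two vectors, which SL₂(ℤ) preserves. -/
theorem fourierTransform_mem_invariantFunctions {N : ℕ} [NeZero N] {Γ : Subgroup SL(2, ℤ)}
    {f : ZVec N → ℂ} (hf : f ∈ invariantFunctions N Γ) :
    fourierTransform f ∈ invariantFunctions N Γ := by
  rw [mem_invariantFunctions_iff] at hf ⊢
  intro γ hγ w
  unfold fourierTransform
  congr 1
  rw [← (rowActEquiv γ).sum_comp]
  refine Finset.sum_congr rfl fun v _ => ?_
  change f (rowAct v γ) * ZMod.stdAddChar (rowAct v γ 0 * rowAct w γ 1 -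
    rowAct v γ 1 * rowAct w γ 0) = _
  rw [rowAct_det, hf γ hγ]

theorem sum_zvec {N : ℕ} [NeZero N] (G : ZMod N → ZMod N → ℂ) :
    ∑ v : ZVec N, G (v 0) (v 1) = ∑ a : ZMod N, ∑ b : ZMod N, G a b := by
  rw [← (finTwoArrowEquiv (ZMod N)).symm.sum_comp, Fintype.sum_prod_type]
  simp [finTwoArrowEquiv]

theorem sum_stdAddChar_det {N : ℕ} [NeZero N] (u w : ZVec N) :
    ∑ v : ZVec N, ZMod.stdAddChar (u 0 * v 1 - u 1 * v 0) *
      ZMod.stdAddChar (v 0 * w 1 - v 1 * w 0) = if u = w then (N : ℂ) ^ 2 else 0 := by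
  have h1 : ∀ v : ZVec N, ZMod.stdAddChar (u 0 * v 1 - u 1 * v 0) *
      ZMod.stdAddChar (v 0 * w 1 - v 1 * w 0) =
      (fun a b => ZMod.stdAddChar (a * (w 1 - u 1)) * ZMod.stdAddChar (b * (u 0 - w 0)))
        (v 0) (v 1) := by
    intro v
    simp only
    rw [← AddChar.map_add_eq_mul, ← AddChar.map_add_eq_mul]
    congr 1; ring
  rw [Finset.sum_congr rfl fun v _ => h1 v,
    sum_zvec fun a b => ZMod.stdAddChar (a * (w 1 - u 1)) * ZMod.stdAddChar (b * (u 0 - w 0))]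
  simp only [← Finset.mul_sum, ← Finset.sum_mul]
  rw [AddChar.sum_mulShift _ (ZMod.isPrimitive_stdAddChar N),
    AddChar.sum_mulShift _ (ZMod.isPrimitive_stdAddChar N), ZMod.card]
  have h2 : u = w ↔ w 1 - u 1 = 0 ∧ u 0 - w 0 = 0 := by
    rw [sub_eq_zero, sub_eq_zero]
    exact ⟨fun h => by simp [h], fun h => by ext i; fin_cases i; exacts [h.2, h.1.symm]⟩
  by_cases h : u = w
  · rw [if_pos h, if_pos (h2.1 h).1, if_pos (h2.1 h).2]; ring
  · rw [if_neg h]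
    rcases not_and_or.1 (h2.not.1 h) with h' | h' <;> simp [h']

/-- The determinant pairing is alternating, so the double transform returns f(v) rather than f(-v).
-/
theorem fourierTransform_fourierTransform {N : ℕ} [NeZero N] (f : ZVec N → ℂ) :
    fourierTransform (fourierTransform f) = f := by
  ext w
  have hN : (N : ℂ) ≠ 0 := by exact_mod_cast NeZero.ne N
  have h1 : ∑ v : ZVec N, (1 / (N : ℂ) * ∑ u : ZVec N, f u *
      ZMod.stdAddChar (u 0 * v 1 - u 1 * v 0)) * ZMod.stdAddChar (v 0 * w 1 - v 1 * w 0) =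
      1 / (N : ℂ) * ∑ u : ZVec N, f u * if u = w then (N : ℂ) ^ 2 else 0 := by
    simp only [← sum_stdAddChar_det, Finset.mul_sum, Finset.sum_mul]
    rw [Finset.sum_comm]
    exact Finset.sum_congr rfl fun u _ => Finset.sum_congr rfl fun v _ => by ring
  unfold fourierTransform
  rw [h1]
  simp
  field_simp

/-- The Fourier transform as a linear map. -/
noncomputable def fourierLinear {N : ℕ} [NeZero N] : (ZVec N → ℂ) →ₗ[ℂ] (ZVec N → ℂ) where
  toFun := fourierTransform
  map_add' f g := by
    ext w
    simp [fourierTransform, add_mul, Finset.sum_add_distrib, mul_add]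
  map_smul' a f := by
    ext w
    simp only [fourierTransform, Pi.smul_apply, smul_eq_mul, RingHom.id_apply, mul_assoc,
      ← Finset.mul_sum]
    ring

theorem eisMap_const_ne_zero (N k : ℕ) [NeZero N] :
    (((k - 1).factorial : ℂ) / (-2 * Complex.I * (Real.pi : ℂ)) ^ k) * (N : ℂ) ^ (k - 1) ≠ 0 := by
  have hN : (N : ℂ) ≠ 0 := by exact_mod_cast NeZero.ne N
  have h1 : ((k - 1).factorial : ℂ) ≠ 0 := by exact_mod_cast (k - 1).factorial_ne_zero
  have h2 : (Real.pi : ℂ) ≠ 0 := by exact_mod_cast Real.pi_ne_zero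
  simp [hN, h1]

/-- The map `Eis_k` as a linear map. -/
noncomputable def eisLinear {N k : ℕ} [NeZero N] (hk : 2 ≤ k) : (ZVec N → ℂ) →ₗ[ℂ] (ℍ → ℂ) :=
  ((((k - 1).factorial : ℂ) / (-2 * Complex.I * (Real.pi : ℂ)) ^ k) * (N : ℂ) ^ (k - 1)) •
    (eisensteinELinear hk ∘ₗ fourierLinear)

theorem eisLinear_apply {N k : ℕ} [NeZero N] (hk : 2 ≤ k) (f : ZVec N → ℂ) :
    eisLinear hk f = eisMap k f := rfl

theorem eisLinear_eq_zero_iff {N k : ℕ} [NeZero N] (hk : 2 ≤ k) (f : ZVec N → ℂ) :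
    eisLinear hk f = 0 ↔ eisensteinE k (fourierTransform f) = 0 := by
  change ((((k - 1).factorial : ℂ) / (-2 * Complex.I * (Real.pi : ℂ)) ^ k) *
    (N : ℂ) ^ (k - 1)) • eisensteinE k (fourierTransform f) = 0 ↔ _
  rw [smul_eq_zero]
  simp only [eisMap_const_ne_zero, false_or]

/-! ### Distribution relations -/

/-- Only pairs (pc, pd) contribute, and the summand is homogeneous of degree -k. Each index is
rescaled separately, so the argument respects Eisenstein summation when k = 2. -/
theorem eisensteinE_of_dilate {N k p : ℕ} (hp : p ≠ 0) (F G : ZVec N → ℂ) (a : ℂ)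
    (h0 : ∀ c d : ℤ, ¬((p : ℤ) ∣ c ∧ (p : ℤ) ∣ d) → F ![(c : ZMod N), (d : ZMod N)] = 0)
    (h1 : ∀ w, F ((p : ZMod N) • w) = a * G w) (z : ℍ) :
    (p : ℂ) ^ k * eisensteinE k F z = a * eisensteinE k G z := by
  have hpZ : (p : ℤ) ≠ 0 := by exact_mod_cast hp
  have hpC : (p : ℂ) ≠ 0 := by exact_mod_cast hp
  have hinj : Function.Injective fun j : ℤ => (p : ℤ) * j := mul_right_injective₀ hpZ
  have hzero : ∀ c d : ℤ, ¬((p : ℤ) ∣ c ∧ (p : ℤ) ∣ d) → eisTerm k F z c d = 0 := by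
    intro c d h
    rw [eisTerm, h0 c d h, zero_div, ite_self]
  have hmul : ∀ c d : ℤ, eisTerm k F z (p * c) (p * d) =
      ((p : ℂ) ^ k)⁻¹ * a * eisTerm k G z c d := by
    intro c d
    simp only [eisTerm, mul_eq_zero, hpZ, false_or]
    split_ifs
    · simp
    · have h2 : (![((p * c : ℤ) : ZMod N), ((p * d : ℤ) : ZMod N)] : ZVec N) =
          (p : ZMod N) • ![(c : ZMod N), (d : ZMod N)] := by
        ext i; fin_cases i <;> simp
      rw [h2, h1]
      push_cast
      rw [mul_assoc, mul_assoc, ← mul_add, mul_pow]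
      field_simp
  have key : eisensteinE k F z = ((p : ℂ) ^ k)⁻¹ * a * eisensteinE k G z := by
    unfold eisensteinE
    split_ifs
    · rw [← hinj.tsum_eq, ← tsum_mul_left]
      · refine tsum_congr fun c => ?_
        rw [← hinj.tsum_eq, ← tsum_mul_left]
        · exact tsum_congr fun d => hmul c d
        · intro d hd
          by_contra hr
          exact hd (hzero _ _ fun h => hr (h.2.imp fun _ => Eq.symm))
      · intro c hc
        by_contra hr
        refine hc ?_
        simp only
        rw [← tsum_zero]
        exact tsum_congr fun d => hzero _ _ fun h => hr (h.1.imp fun _ => Eq.symm)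
    · rw [← (hinj.prodMap hinj).tsum_eq, ← tsum_mul_left]
      · exact tsum_congr fun q => hmul q.1 q.2
      · rintro ⟨c, d⟩ hq
        by_contra hr
        refine hq (hzero _ _ fun h => hr ?_)
        obtain ⟨⟨c', rfl⟩, ⟨d', rfl⟩⟩ := h
        exact ⟨(c', d'), rfl⟩
  rw [key]
  field_simp

theorem card_smul_eq_zero {N p : ℕ} [NeZero N] (hp : p ∣ N) :
    (Finset.univ.filter fun x : ZMod N => (p : ZMod N) * x = 0).card = p := by
  obtain ⟨m, hm⟩ := hp
  have hN : N ≠ 0 := NeZero.ne N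
  have hp0 : 0 < p := Nat.pos_of_ne_zero (by rintro rfl; simp at hm; exact hN hm)
  have hm0 : 0 < m := Nat.pos_of_ne_zero (by rintro rfl; simp at hm; exact hN hm)
  have himg : (Finset.univ.filter fun x : ZMod N => (p : ZMod N) * x = 0) =
      (Finset.range p).image fun j : ℕ => ((m * j : ℕ) : ZMod N) := by
    ext x
    simp only [Finset.mem_filter, Finset.mem_univ, true_and, Finset.mem_image, Finset.mem_range]
    constructor
    · intro hx
      rw [← ZMod.natCast_zmod_val x, ← Nat.cast_mul, ZMod.natCast_eq_zero_iff] at hx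
      nth_rw 1 [hm] at hx
      obtain ⟨j, hj⟩ := Nat.dvd_of_mul_dvd_mul_left hp0 hx
      refine ⟨j, ?_, by rw [← hj, ZMod.natCast_zmod_val]⟩
      have h3 := ZMod.val_lt x
      rw [hj] at h3
      replace h3 : m * j < m * p := by rwa [mul_comm m p, ← hm]
      exact lt_of_mul_lt_mul_left h3 (Nat.zero_le _)
    · rintro ⟨j, -, rfl⟩
      rw [← Nat.cast_mul, ← mul_assoc, ← hm]
      simp
  rw [himg, Finset.card_image_of_injOn, Finset.card_range]
  intro a ha b hb hab
  have hlt : ∀ j ∈ (Finset.range p : Set ℕ), m * j < N := by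
    intro j hj
    rw [hm, mul_comm p m]
    exact Nat.mul_lt_mul_of_pos_left (Finset.mem_range.1 hj) hm0
  have := congrArg ZMod.val hab
  simp only [ZMod.val_natCast_of_lt (hlt a ha), ZMod.val_natCast_of_lt (hlt b hb)] at this
  exact Nat.eq_of_mul_eq_mul_left hm0 this

theorem card_smul_fiber {N p : ℕ} [NeZero N] (hp : p ∣ N) (v : ZVec N) :
    (Finset.univ.filter fun w : ZVec N => (p : ZMod N) • w = (p : ZMod N) • v).card = p ^ 2 := by
  have h1 : (Finset.univ.filter fun w : ZVec N => (p : ZMod N) • w = (p : ZMod N) • v) =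
      (Fintype.piFinset fun _ : Fin 2 =>
        Finset.univ.filter fun x : ZMod N => (p : ZMod N) * x = 0).map
        (Equiv.addRight v).toEmbedding := by
    ext w
    simp only [Finset.mem_filter, Finset.mem_univ, true_and, Finset.mem_map_equiv,
      Equiv.addRight_symm, Equiv.coe_addRight, Fintype.mem_piFinset]
    rw [← sub_eq_zero, ← smul_sub, funext_iff]
    simp [sub_eq_add_neg]
  rw [h1, Finset.card_map, Fintype.card_piFinset]
  simp [card_smul_eq_zero hp]

theorem sum_comp_smul {N p : ℕ} [NeZero N] (hp : p ∣ N) (G : ZVec N → ℂ)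
    (hG : ∀ w, (¬ ∃ v, (p : ZMod N) • v = w) → G w = 0) :
    ∑ v : ZVec N, G ((p : ZMod N) • v) = (p : ℂ) ^ 2 * ∑ w : ZVec N, G w := by
  rw [← Finset.sum_fiberwise (s := Finset.univ) (g := fun v : ZVec N => (p : ZMod N) • v),
    Finset.mul_sum]
  refine Finset.sum_congr rfl fun w _ => ?_
  rw [Finset.sum_congr rfl (g := fun _ => G w) fun v hv => by rw [(Finset.mem_filter.1 hv).2]]
  rw [Finset.sum_const]
  by_cases h : ∃ v, (p : ZMod N) • v = w
  · obtain ⟨v, rfl⟩ := h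
    rw [card_smul_fiber hp v]
    simp
  · rw [hG w h]; simp

theorem stdAddChar_div_mul_ne_one {N p : ℕ} [NeZero N] (hp : p ∣ N) (c : ℤ) (hc : ¬(p : ℤ) ∣ c) :
    ZMod.stdAddChar (((N / p : ℕ) : ZMod N) * (c : ZMod N)) ≠ 1 := by
  intro h
  rw [← AddChar.map_zero_eq_one (ZMod.stdAddChar (N := N))] at h
  have h2 := ZMod.injective_stdAddChar h
  have hm : 0 < N / p := Nat.div_pos (Nat.le_of_dvd (Nat.pos_of_ne_zero (NeZero.ne N)) hp)
    (Nat.pos_of_dvd_of_pos hp (Nat.pos_of_ne_zero (NeZero.ne N)))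
  have h3 : (((N / p : ℕ) * c : ℤ) : ZMod N) = 0 := by rw [Int.cast_mul, Int.cast_natCast]; exact h2
  rw [ZMod.intCast_zmod_eq_zero_iff_dvd] at h3
  have h4 : (N : ℤ) = (N / p : ℕ) * (p : ℤ) := by exact_mod_cast (Nat.div_mul_cancel hp).symm
  rw [h4] at h3
  exact hc (Int.dvd_of_mul_dvd_mul_left (by exact_mod_cast hm.ne') h3)

/-- Pairing v with pw equals pairing pv with w, and each multiple of p is hit by exactly p² vectors
v. -/
theorem fourierTransform_comp_smul {N p : ℕ} [NeZero N] (hp : p ∣ N) (g : ZVec N → ℂ)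
    (hg : ∀ w, (¬ ∃ v, (p : ZMod N) • v = w) → g w = 0) (w : ZVec N) :
    fourierTransform (fun v => g ((p : ZMod N) • v)) ((p : ZMod N) • w) =
      (p : ℂ) ^ 2 * fourierTransform g w := by
  unfold fourierTransform
  have := sum_comp_smul hp (fun v => g v * ZMod.stdAddChar (v 0 * w 1 - v 1 * w 0))
    (fun v hv => by rw [hg v hv, zero_mul])
  rw [mul_left_comm, ← this]
  congr 1
  refine Finset.sum_congr rfl fun v _ => ?_
  simp only [Pi.smul_apply, smul_eq_mul]
  congr 2
  ring

/-- Translation by p-torsion fixes v ↦ g(pv) but multiplies the Fourier sum by a character value. A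
torsion vector with single nonzero entry N/p makes that value different from 1 when p does not
divide c, or d. -/
theorem fourierTransform_comp_smul_eq_zero {N p : ℕ} [NeZero N] (hp : p ∣ N) (g : ZVec N → ℂ)
    (c d : ℤ) (h : ¬((p : ℤ) ∣ c ∧ (p : ℤ) ∣ d)) :
    fourierTransform (fun v => g ((p : ZMod N) • v)) ![(c : ZMod N), (d : ZMod N)] = 0 := by
  unfold fourierTransform
  rw [mul_eq_zero]
  right
  have hpN : (p : ZMod N) * ((N / p : ℕ) : ZMod N) = 0 := by
    rw [← Nat.cast_mul, Nat.mul_div_cancel' hp]; simp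
  set S := ∑ v : ZVec N, g ((p : ZMod N) • v) *
    ZMod.stdAddChar (v 0 * (![(c : ZMod N), (d : ZMod N)] : ZVec N) 1 -
      v 1 * (![(c : ZMod N), (d : ZMod N)] : ZVec N) 0) with hS
  have key : ∀ e : ZVec N, (p : ZMod N) • e = 0 →
      S * ZMod.stdAddChar (e 0 * (d : ZMod N) - e 1 * (c : ZMod N)) = S := by
    intro e he
    conv_rhs => rw [hS, ← Equiv.sum_comp (Equiv.addRight e)]
    rw [hS, Finset.sum_mul]
    refine Finset.sum_congr rfl fun v _ => ?_
    simp only [Equiv.coe_addRight, smul_add, he, add_zero, Pi.add_apply, Matrix.cons_val_zero,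
      Matrix.cons_val_one, Matrix.cons_val_fin_one]
    rw [mul_assoc, ← AddChar.map_add_eq_mul]
    congr 2
    ring
  by_contra hS0
  have key2 : ∀ e : ZVec N, (p : ZMod N) • e = 0 → ZMod.stdAddChar (e 0 * (d : ZMod N) - e 1 * (c : ZMod N)) = 1 :=
    fun e he => mul_left_cancel₀ hS0 ((key e he).trans (mul_one S).symm)
  rcases not_and_or.1 h with h | h
  · refine stdAddChar_div_mul_ne_one hp (-c) (by rwa [dvd_neg]) ?_
    have := key2 ![0, ((N / p : ℕ) : ZMod N)] (by ext i; fin_cases i <;> simp [hpN])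
    simpa using this
  · refine stdAddChar_div_mul_ne_one hp d h ?_
    have := key2 ![((N / p : ℕ) : ZMod N), 0] (by ext i; fin_cases i <;> simp [hpN])
    simpa using this

/-- A linear map on functions on `(ℤ/Nℤ)²` satisfies the distribution relations of weight `k` if
replacing a function supported on multiples of a prime `p ∣ N` by its dilate scales the value
by `p ^ (2 - k)`. -/
def SatisfiesDistribution {N : ℕ} {X : Type*} [AddCommGroup X] [Module ℂ X] (k : ℕ)
    (L : (ZVec N → ℂ) →ₗ[ℂ] X) : Prop :=
  ∀ p : ℕ, p.Prime → p ∣ N → ∀ g : ZVec N → ℂ, (∀ w, (¬ ∃ v, (p : ZMod N) • v = w) → g w = 0) →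
    (p : ℂ) ^ k • L (fun v => g ((p : ZMod N) • v)) = (p : ℂ) ^ 2 • L g

theorem satisfiesDistribution_eisLinear {N k : ℕ} [NeZero N] (hk : 2 ≤ k) :
    SatisfiesDistribution k (eisLinear (N := N) hk) := by
  intro p hp hpN g hg
  ext z
  have := eisensteinE_of_dilate (k := k) hp.ne_zero _ (fourierTransform g) ((p : ℂ) ^ 2)
    (fun c d h => fourierTransform_comp_smul_eq_zero hpN g c d h)
    (fun w => fourierTransform_comp_smul hpN g hg w) z
  simp only [eisLinear_apply, Pi.smul_apply, smul_eq_mul, eisMap]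
  rw [mul_left_comm, this]
  ring

/-! ### Types of vectors and Γ₀(N)-orbits -/

/-- For `N = A * B * D`, the vectors `(x, y)` with `gcd (x, N) = B * D` and
`gcd (y, B * D) = D`. -/
def typeSet (N B D : ℕ) : Set (ZVec N) :=
  {v | Nat.gcd (v 0).val N = B * D ∧ Nat.gcd (v 1).val (B * D) = D}

/-- The product `(x / (B * D)) * (y / D)` classifying the orbits in `typeSet N B D`. -/
def typeInv {N : ℕ} (B D : ℕ) (v : ZVec N) : ℕ := ((v 0).val / (B * D)) * ((v 1).val / D)

theorem exists_val_eq_mul {N q m : ℕ} [NeZero N] (hN : N = q * m) {x : ZMod N} {s : ℤ}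
    (hx : x = ((q * s : ℤ) : ZMod N)) : ∃ s' : ℕ, x.val = q * s' ∧ (m : ℤ) ∣ s' - s := by
  have hq : (q : ℤ) ≠ 0 := by
    rintro h
    have : q = 0 := by exact_mod_cast h
    exact NeZero.ne N (by rw [hN, this, zero_mul])
  have h1 : ((x.val : ℤ) : ZMod N) = ((q * s : ℤ) : ZMod N) := by
    rw [← hx]; simp
  rw [ZMod.intCast_eq_intCast_iff_dvd_sub] at h1
  have h2 : (q : ℤ) ∣ x.val := by
    have h3 : (q : ℤ) ∣ q * s - x.val := (Dvd.intro (m : ℤ) (by rw [hN]; push_cast; ring)).trans h1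
    exact (dvd_sub_right (Dvd.intro _ rfl)).1 h3
  obtain ⟨s', hs'⟩ := Int.natCast_dvd_natCast.1 h2
  refine ⟨s', hs', ?_⟩
  rw [hs', hN] at h1
  push_cast at h1
  rw [← mul_sub] at h1
  rw [← dvd_neg, neg_sub]
  exact Int.dvd_of_mul_dvd_mul_left hq h1

theorem exists_rep_of_mem_typeSet {N A B D : ℕ} [NeZero N] (hN : N = A * B * D) {v : ZVec N}
    (hv : v ∈ typeSet N B D) : ∃ s t : ℤ, IsCoprime s A ∧ IsCoprime t B ∧
      v 0 = ((B * D * s : ℤ) : ZMod N) ∧ v 1 = ((D * t : ℤ) : ZMod N) ∧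
      (typeInv B D v : ℤ) = s * t := by
  obtain ⟨h0, h1⟩ := hv
  have hN0 : A * B * D ≠ 0 := hN ▸ NeZero.ne N
  have hD : 0 < D := Nat.pos_of_ne_zero (right_ne_zero_of_mul hN0)
  have hB : 0 < B := Nat.pos_of_ne_zero (right_ne_zero_of_mul (left_ne_zero_of_mul hN0))
  have hBD : 0 < B * D := Nat.mul_pos hB hD
  obtain ⟨s, hs⟩ : B * D ∣ (v 0).val := h0 ▸ Nat.gcd_dvd_left _ _
  obtain ⟨t, ht⟩ : D ∣ (v 1).val := by
    have := Nat.gcd_dvd_left (v 1).val (B * D)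
    rwa [h1] at this
  refine ⟨s, t, ?_, ?_, ?_, ?_, ?_⟩
  · rw [Nat.isCoprime_iff_coprime]
    rw [hs] at h0
    nth_rw 1 [hN] at h0
    rw [mul_assoc A, mul_comm A, Nat.gcd_mul_left] at h0
    exact Nat.eq_of_mul_eq_mul_left hBD (h0.trans (mul_one _).symm)
  · rw [Nat.isCoprime_iff_coprime]
    rw [ht, mul_comm B, Nat.gcd_mul_left] at h1
    exact Nat.eq_of_mul_eq_mul_left hD (h1.trans (mul_one _).symm)
  · rw [← ZMod.natCast_zmod_val (v 0), hs]; push_cast; rfl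
  · rw [← ZMod.natCast_zmod_val (v 1), ht]; push_cast; rfl
  · rw [typeInv, hs, ht, Nat.mul_div_cancel_left _ hBD, Nat.mul_div_cancel_left _ hD]
    push_cast; rfl

theorem isCoprime_of_dvd_sub {a b m : ℤ} (h : m ∣ a - b) (hb : IsCoprime b m) : IsCoprime a m := by
  obtain ⟨c, hc⟩ := h
  have : a = b + m * c := by linarith
  rw [this]
  exact hb.add_mul_left_left c

/-- The class of x determines s mod A, and that of y determines t mod AB, so st is well defined
modulo gcd(A,B). -/
theorem mem_typeSet_of_rep {N A B D : ℕ} [NeZero N] (hN : N = A * B * D) {v : ZVec N} {s t : ℤ}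
    (hs : IsCoprime s A) (ht : IsCoprime t B) (h0 : v 0 = ((B * D * s : ℤ) : ZMod N))
    (h1 : v 1 = ((D * t : ℤ) : ZMod N)) :
    v ∈ typeSet N B D ∧ ((Nat.gcd A B : ℕ) : ℤ) ∣ (typeInv B D v : ℤ) - s * t := by
  have hN0 : A * B * D ≠ 0 := hN ▸ NeZero.ne N
  have hD : 0 < D := Nat.pos_of_ne_zero (right_ne_zero_of_mul hN0)
  have hB : 0 < B := Nat.pos_of_ne_zero (right_ne_zero_of_mul (left_ne_zero_of_mul hN0))
  have hBD : 0 < B * D := Nat.mul_pos hB hD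
  obtain ⟨s', hs', hss⟩ := exists_val_eq_mul (q := B * D) (m := A) (by rw [hN]; ring)
    (s := s) (x := v 0) (by rw [h0]; push_cast; rfl)
  obtain ⟨t', ht', htt⟩ := exists_val_eq_mul (q := D) (m := A * B) (by rw [hN]; ring)
    (s := t) (x := v 1) h1
  have hcs : Nat.Coprime s' A := Nat.isCoprime_iff_coprime.1 (isCoprime_of_dvd_sub hss hs)
  have htB : (B : ℤ) ∣ t' - t := (Dvd.intro_left (A : ℤ) (by push_cast; rfl)).trans htt
  have hct : Nat.Coprime t' B := Nat.isCoprime_iff_coprime.1 (isCoprime_of_dvd_sub htB ht)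
  refine ⟨⟨?_, ?_⟩, ?_⟩
  · rw [hs']
    nth_rw 1 [hN]
    rw [mul_assoc A, mul_comm A, Nat.gcd_mul_left, hcs, mul_one]
  · rw [ht', mul_comm B, Nat.gcd_mul_left, hct, mul_one]
  · rw [typeInv, hs', ht', Nat.mul_div_cancel_left _ hBD, Nat.mul_div_cancel_left _ hD]
    have e1 : ((Nat.gcd A B : ℕ) : ℤ) ∣ s' - s :=
      (Int.natCast_dvd_natCast.2 (Nat.gcd_dvd_left _ _)).trans hss
    have e2 : ((Nat.gcd A B : ℕ) : ℤ) ∣ t' - t :=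
      (Int.natCast_dvd_natCast.2 (Nat.gcd_dvd_right _ _)).trans htB
    have : ((s' * t' : ℕ) : ℤ) - s * t = (s' - s) * t' + s * (t' - t) := by push_cast; ring
    rw [this]
    exact (e1.mul_right _).add (e2.mul_left _)

theorem exists_mem_typeSet (N : ℕ) [NeZero N] (v : ZVec N) :
    ∃ A B D : ℕ, N = A * B * D ∧ v ∈ typeSet N B D := by
  obtain ⟨A, hA⟩ := Nat.gcd_dvd_right (v 0).val N
  obtain ⟨B, hB⟩ := Nat.gcd_dvd_right (v 1).val (Nat.gcd (v 0).val N)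
  refine ⟨A, B, Nat.gcd (v 1).val (Nat.gcd (v 0).val N), ?_, ?_, ?_⟩
  · conv_lhs => rw [hA]
    conv_lhs => rw [hB]
    ring
  · conv_lhs => rw [hB]
    ring
  · have : B * Nat.gcd (v 1).val (Nat.gcd (v 0).val N) = Nat.gcd (v 0).val N := by
      conv_rhs => rw [hB]
      ring
    rw [this]

theorem typeSet_unique {N A B D A' B' D' : ℕ} [NeZero N] (hN : N = A * B * D)
    (hN' : N = A' * B' * D') {v : ZVec N} (hv : v ∈ typeSet N B D) (hv' : v ∈ typeSet N B' D') :
    A = A' ∧ B = B' ∧ D = D' := by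
  have h1 : B * D = B' * D' := hv.1.symm.trans hv'.1
  have hD : D = D' := by rw [← hv.2, h1, hv'.2]
  subst hD
  have hN0 : A * B * D ≠ 0 := hN ▸ NeZero.ne N
  have hD0 : D ≠ 0 := right_ne_zero_of_mul hN0
  have hB0 : B ≠ 0 := right_ne_zero_of_mul (left_ne_zero_of_mul hN0)
  have hB : B = B' := Nat.eq_of_mul_eq_mul_right (Nat.pos_of_ne_zero hD0) h1
  subst hB
  refine ⟨?_, rfl, rfl⟩
  refine Nat.eq_of_mul_eq_mul_right (Nat.pos_of_ne_zero (mul_ne_zero hB0 hD0)) ?_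
  rw [← mul_assoc, ← mul_assoc, ← hN, ← hN']

theorem gamma0_entries {N : ℕ} {γ : SL(2, ℤ)} (hγ : γ ∈ CongruenceSubgroup.Gamma0 N) :
    (N : ℤ) ∣ γ 1 0 ∧ (N : ℤ) ∣ γ 0 0 * γ 1 1 - 1 := by
  have h := (ZMod.intCast_zmod_eq_zero_iff_dvd _ _).1 (CongruenceSubgroup.Gamma0_mem.1 hγ)
  refine ⟨h, ?_⟩
  have hd := γ.det_coe
  rw [Matrix.det_fin_two] at hd
  have : γ 0 0 * γ 1 1 - 1 = γ 0 1 * γ 1 0 := by linarith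
  rw [this]
  exact h.mul_left _

/-- Modulo N, a matrix with rows (a,b), (0,d) sends (s,t) to (sa, td + Bsb), with ad ≡ 1. The
product st changes by a multiple of gcd(A,B). -/
theorem rowAct_gamma0_mem_typeSet {N A B D : ℕ} [NeZero N] (hN : N = A * B * D) {v : ZVec N}
    (hv : v ∈ typeSet N B D) {γ : SL(2, ℤ)} (hγ : γ ∈ CongruenceSubgroup.Gamma0 N) :
    rowAct v γ ∈ typeSet N B D ∧
      ((Nat.gcd A B : ℕ) : ℤ) ∣ (typeInv B D (rowAct v γ) : ℤ) - typeInv B D v := by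
  obtain ⟨s, t, hs, ht, h0, h1, hst⟩ := exists_rep_of_mem_typeSet hN hv
  obtain ⟨hc, hd⟩ := gamma0_entries hγ
  have hAN : (A : ℤ) ∣ N := Int.natCast_dvd_natCast.2 ⟨B * D, by rw [hN]; ring⟩
  have hBN : (B : ℤ) ∣ N := Int.natCast_dvd_natCast.2 ⟨A * D, by rw [hN]; ring⟩
  have hunit : ∀ m : ℤ, m ∣ N → IsCoprime (γ 0 0) m ∧ IsCoprime (γ 1 1) m := by
    intro m hm
    have h3 : IsCoprime (γ 0 0 * γ 1 1) m :=
      isCoprime_of_dvd_sub (hm.trans hd) isCoprime_one_left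
    exact ⟨h3.of_mul_left_left, h3.of_mul_left_right⟩
  have hc0 : ((γ 1 0 : ℤ) : ZMod N) = 0 := (ZMod.intCast_zmod_eq_zero_iff_dvd _ _).2 hc
  obtain ⟨h3, h4⟩ := mem_typeSet_of_rep hN (v := rowAct v γ) (s := s * γ 0 0)
    (t := t * γ 1 1 + B * (s * γ 0 1)) (hs.mul_left (hunit _ hAN).1)
    ((ht.mul_left (hunit _ hBN).2).add_mul_left_left _)
    (by rw [rowAct_zero_apply, hc0, h0]; push_cast; ring)
    (by rw [rowAct_one_apply, h0, h1]; push_cast; ring)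
  refine ⟨h3, ?_⟩
  have e1 : ((Nat.gcd A B : ℕ) : ℤ) ∣ B := Int.natCast_dvd_natCast.2 (Nat.gcd_dvd_right _ _)
  have : (typeInv B D (rowAct v γ) : ℤ) - typeInv B D v =
      (typeInv B D (rowAct v γ) - s * γ 0 0 * (t * γ 1 1 + B * (s * γ 0 1))) +
      (s * t * (γ 0 0 * γ 1 1 - 1) + B * (s * γ 0 0 * (s * γ 0 1))) := by
    rw [hst]; ring
  rw [this]
  exact h4.add (((e1.trans (hBN.trans hd)).mul_left _).add (e1.mul_right _))

theorem exists_coprime_lift {m N : ℕ} [NeZero N] (hm : m ∣ N) {a : ℤ} (ha : IsCoprime a m) :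
    ∃ b : ℤ, IsCoprime b N ∧ (m : ℤ) ∣ b - a := by
  obtain ⟨u, hu⟩ := ZMod.unitsMap_surjective hm (ZMod.unitOfIsCoprime a ha)
  refine ⟨(u : ZMod N).val, Nat.isCoprime_iff_coprime.2 (ZMod.val_coe_unit_coprime u), ?_⟩
  have := congrArg (fun u : (ZMod m)ˣ => (u : ZMod m)) hu
  simp only [ZMod.unitsMap_val, ZMod.coe_unitOfIsCoprime] at this
  rw [← ZMod.intCast_eq_intCast_iff_dvd_sub, ← this]
  simp [ZMod.natCast_val]

theorem exists_mul_sub_one_dvd {a m : ℤ} (h : IsCoprime a m) : ∃ b : ℤ, m ∣ a * b - 1 := by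
  obtain ⟨x, y, hxy⟩ := h
  exact ⟨x, -y, by linarith⟩

theorem exists_int_crt {A B : ℕ} {a b : ℤ} (h : ((Nat.gcd A B : ℕ) : ℤ) ∣ a - b) :
    ∃ c : ℤ, (A : ℤ) ∣ c - a ∧ (B : ℤ) ∣ c - b := by
  obtain ⟨m, hm⟩ := h
  refine ⟨a - A * (Nat.gcdA A B * m), ⟨-(Nat.gcdA A B * m), by ring⟩, ⟨Nat.gcdB A B * m, ?_⟩⟩
  have := Nat.gcd_eq_gcd_ab A B
  rw [this] at hm
  linear_combination hm

/-- A unit a mod N is needed with a ≡ s's⁻¹ mod A and a ≡ t t'⁻¹ mod B; the condition st ≡ s't' mod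
gcd(A,B) makes these congruences compatible. A unipotent matrix then corrects y, which is off by a
multiple of BD. -/
theorem exists_gamma0_of_typeInv {N A B D : ℕ} [NeZero N] (hN : N = A * B * D) {v w : ZVec N}
    (hv : v ∈ typeSet N B D) (hw : w ∈ typeSet N B D)
    (hvw : ((Nat.gcd A B : ℕ) : ℤ) ∣ (typeInv B D v : ℤ) - typeInv B D w) :
    ∃ γ ∈ CongruenceSubgroup.Gamma0 N, w = rowAct v γ := by
  obtain ⟨s, t, hs, ht, hv0, hv1, hst⟩ := exists_rep_of_mem_typeSet hN hv
  obtain ⟨s', t', hs', ht', hw0, hw1, hst'⟩ := exists_rep_of_mem_typeSet hN hw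
  rw [hst, hst'] at hvw
  obtain ⟨si, hsi⟩ := exists_mul_sub_one_dvd hs
  obtain ⟨ti, hti⟩ := exists_mul_sub_one_dvd ht'
  have eA : ((Nat.gcd A B : ℕ) : ℤ) ∣ A := Int.natCast_dvd_natCast.2 (Nat.gcd_dvd_left _ _)
  have eB : ((Nat.gcd A B : ℕ) : ℤ) ∣ B := Int.natCast_dvd_natCast.2 (Nat.gcd_dvd_right _ _)
  have hcompat : ((Nat.gcd A B : ℕ) : ℤ) ∣ s' * si - t * ti := by
    have : s' * si - t * ti = -(s * t - s' * t') * (si * ti) + (s * si - 1) * (t * ti) -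
        (t' * ti - 1) * (s' * si) := by ring
    rw [this]
    exact ((hvw.neg_right.mul_right _).add ((eA.trans hsi).mul_right _)).sub
      ((eB.trans hti).mul_right _)
  obtain ⟨a₀, haA, haB⟩ := exists_int_crt hcompat
  have hsi' : IsCoprime si (A : ℤ) :=
    (isCoprime_of_dvd_sub hsi isCoprime_one_left).of_mul_left_right
  have hti' : IsCoprime ti (B : ℤ) :=
    (isCoprime_of_dvd_sub hti isCoprime_one_left).of_mul_left_right
  have hcA : IsCoprime a₀ (A : ℤ) := isCoprime_of_dvd_sub haA (hs'.mul_left hsi')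
  have hcB : IsCoprime a₀ (B : ℤ) := isCoprime_of_dvd_sub haB (ht.mul_left hti')
  obtain ⟨a, haN, ha⟩ := exists_coprime_lift (m := A * B) (N := N) ⟨D, hN⟩ (a := a₀)
    (by push_cast; exact hcA.mul_right hcB)
  push_cast at ha
  obtain ⟨d, hd⟩ := exists_mul_sub_one_dvd haN
  have hBN : (B : ℤ) ∣ N := Int.natCast_dvd_natCast.2 ⟨A * D, by rw [hN]; ring⟩
  have hsa : (A : ℤ) ∣ s * a - s' := by
    have : s * a - s' = s * (a - a₀) + s * (a₀ - s' * si) + s' * (s * si - 1) := by ring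
    rw [this]
    exact ((((Dvd.intro _ rfl).trans ha).mul_left _).add (haA.mul_left _)).add (hsi.mul_left _)
  have htd : (B : ℤ) ∣ t * d - t' := by
    have : t * d - t' = d * t * (1 - t' * ti) + d * t' * (t * ti - a₀) + d * t' * (a₀ - a) +
        t' * (a * d - 1) := by ring
    rw [this]
    refine (((?_ : (B : ℤ) ∣ _).add ?_).add ?_).add ?_
    · rw [← neg_sub (t' * ti)]; exact hti.neg_right.mul_left _
    · rw [← neg_sub a₀]; exact haB.neg_right.mul_left _
    · rw [← neg_sub a]; exact ((Dvd.intro_left _ rfl).trans ha).neg_right.mul_left _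
    · exact (hBN.trans hd).mul_left _
  obtain ⟨w', hw'⟩ := htd
  obtain ⟨si', hsi'⟩ := exists_mul_sub_one_dvd hs'
  let γ₁ : SL(2, ℤ) := ⟨!![a, 1; a * d - 1, d], by rw [Matrix.det_fin_two_of]; ring⟩
  -- After `γ₁` the second coordinate is Dt' + BD(w' + s) and the first is BDs'. As s' si' ≡ 1 mod
  -- A, adding -(w' + s)si' times the first cancels the excess mod N = ABD.
  let γ₂ : SL(2, ℤ) := ⟨!![1, -(w' + s) * si'; 0, 1], by rw [Matrix.det_fin_two_of]; ring⟩
  have hγ₁ : γ₁ ∈ CongruenceSubgroup.Gamma0 N := by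
    rw [CongruenceSubgroup.Gamma0_mem]
    exact (ZMod.intCast_zmod_eq_zero_iff_dvd _ _).2 hd
  have hγ₂ : γ₂ ∈ CongruenceSubgroup.Gamma0 N := by
    rw [CongruenceSubgroup.Gamma0_mem]
    simp [γ₂]
  have hNZ : (N : ℤ) = A * B * D := by rw [hN]; push_cast; rfl
  refine ⟨γ₁ * γ₂, mul_mem hγ₁ hγ₂, ?_⟩
  have hx : rowAct v γ₁ 0 = w 0 := by
    rw [rowAct_zero_apply, hv0, hv1, hw0]
    change ((B * D * s : ℤ) : ZMod N) * (a : ℤ) + ((D * t : ℤ) : ZMod N) * ((a * d - 1 : ℤ)) = _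
    rw [(ZMod.intCast_zmod_eq_zero_iff_dvd (a * d - 1) N).2 hd, mul_zero, add_zero,
      ← Int.cast_mul, eq_comm, ZMod.intCast_eq_intCast_iff_dvd_sub, hNZ]
    obtain ⟨c, hc⟩ := hsa
    exact ⟨c, by linear_combination (B * D : ℤ) * hc⟩
  rw [rowAct_mul]
  ext i
  fin_cases i
  · change w 0 = rowAct (rowAct v γ₁) γ₂ 0
    rw [rowAct_zero_apply, hx]
    simp [γ₂]
  · change w 1 = rowAct (rowAct v γ₁) γ₂ 1
    rw [rowAct_one_apply, hx, rowAct_one_apply, hv0, hv1, hw0, hw1]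
    change _ = ((B * D * s' : ℤ) : ZMod N) * ((-(w' + s) * si' : ℤ)) +
      (((B * D * s : ℤ) : ZMod N) * ((1 : ℤ)) + ((D * t : ℤ) : ZMod N) * (d : ℤ)) * ((1 : ℤ))
    rw [← Int.cast_mul, ← Int.cast_mul, ← Int.cast_mul, ← Int.cast_add, ← Int.cast_mul,
      ← Int.cast_add, ZMod.intCast_eq_intCast_iff_dvd_sub, hNZ]
    obtain ⟨c, hc⟩ := hsi'
    exact ⟨-(w' + s) * c, by linear_combination (D : ℤ) * hw' - (w' + s) * B * D * hc⟩

theorem exists_mem_typeSet_typeInv {N A B D : ℕ} [NeZero N] (hN : N = A * B * D) {u : ℤ}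
    (hu : IsCoprime u (Nat.gcd A B : ℕ)) :
    ∃ v : ZVec N, v ∈ typeSet N B D ∧ ((Nat.gcd A B : ℕ) : ℤ) ∣ (typeInv B D v : ℤ) - u := by
  have hA : NeZero A := ⟨by rintro rfl; exact NeZero.ne N (by rw [hN]; simp)⟩
  obtain ⟨s, hs, hsu⟩ := exists_coprime_lift (Nat.gcd_dvd_left A B) hu
  obtain ⟨h1, h2⟩ := mem_typeSet_of_rep hN (v := ![((B * D * s : ℤ) : ZMod N),
    ((D * 1 : ℤ) : ZMod N)]) hs isCoprime_one_left rfl rfl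
  refine ⟨_, h1, ?_⟩
  have := h2.add hsu
  rwa [mul_one s, sub_add_sub_cancel] at this

theorem typeInv_isCoprime {N A B D : ℕ} [NeZero N] (hN : N = A * B * D) {v : ZVec N}
    (hv : v ∈ typeSet N B D) : IsCoprime (typeInv B D v : ℤ) (Nat.gcd A B : ℕ) := by
  obtain ⟨s, t, hs, ht, -, -, hst⟩ := exists_rep_of_mem_typeSet hN hv
  rw [hst]
  exact (hs.of_isCoprime_of_dvd_right (Int.natCast_dvd_natCast.2 (Nat.gcd_dvd_left _ _))).mul_left
    (ht.of_isCoprime_of_dvd_right (Int.natCast_dvd_natCast.2 (Nat.gcd_dvd_right _ _)))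

theorem tripleOrbit_eq_rowOrbit {N A B D m : ℕ} [NeZero N] (hN : N = A * B * D)
    (hm : m = Nat.gcd A B) (u : (ZMod m)ˣ) {v : ZVec N} (hv : v ∈ tripleOrbit N (B * D) D u) :
    tripleOrbit N (B * D) D u = rowOrbit (CongruenceSubgroup.Gamma0 N) v := by
  subst hm
  have hmem : ∀ w : ZVec N, w ∈ tripleOrbit N (B * D) D u ↔ w ∈ typeSet N B D ∧
      ((typeInv B D w : ℤ) : ZMod (Nat.gcd A B)) = u := by
    intro w
    rw [Int.cast_natCast]
    exact (and_assoc (c := ((typeInv B D w : ℕ) : ZMod (Nat.gcd A B)) = u)).symm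
  rw [hmem] at hv
  ext w
  rw [hmem]
  constructor
  · rintro ⟨h1, h2⟩
    refine exists_gamma0_of_typeInv hN hv.1 h1 ?_
    rw [← ZMod.intCast_eq_intCast_iff_dvd_sub, h2, hv.2]
  · rintro ⟨γ, hγ, rfl⟩
    obtain ⟨h1, h2⟩ := rowAct_gamma0_mem_typeSet hN hv.1 hγ
    refine ⟨h1, ?_⟩
    rw [← hv.2, eq_comm, ZMod.intCast_eq_intCast_iff_dvd_sub]
    exact h2

theorem tripleOrbit_nonempty {N A B D m : ℕ} [NeZero N] (hN : N = A * B * D)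
    (hm : m = Nat.gcd A B) (u : (ZMod m)ˣ) : (tripleOrbit N (B * D) D u).Nonempty := by
  subst hm
  have hg : Nat.gcd A B ≠ 0 := by
    intro h
    rw [Nat.gcd_eq_zero_iff] at h
    exact NeZero.ne N (by rw [hN, h.1]; simp)
  have : NeZero (Nat.gcd A B) := ⟨hg⟩
  obtain ⟨v, h1, h2⟩ := exists_mem_typeSet_typeInv hN (u := (u : ZMod (Nat.gcd A B)).val)
    (Nat.isCoprime_iff_coprime.2 (ZMod.val_coe_unit_coprime u))
  refine ⟨v, h1.1, h1.2, ?_⟩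
  change ((typeInv B D v : ℕ) : ZMod (Nat.gcd A B)) = u
  rw [← ZMod.intCast_eq_intCast_iff_dvd_sub] at h2
  rw [← Int.cast_natCast, ← h2]
  simp

/-- Multiplication by a prime `p ∣ N` changes the type in one of three ways. -/
theorem smul_mem_typeSet {N A B D p : ℕ} [NeZero N] (hp : p.Prime) (hN : N = A * B * D)
    {v : ZVec N} (hv : v ∈ typeSet N B D) :
    (∃ A', A = p * A' ∧ (p : ZMod N) • v ∈ typeSet N B (p * D)) ∨
    (¬ p ∣ A ∧ ∃ B', B = p * B' ∧ (p : ZMod N) • v ∈ typeSet N B' (p * D)) ∨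
    (¬ p ∣ A ∧ ¬ p ∣ B ∧ (p : ZMod N) • v ∈ typeSet N B D) := by
  obtain ⟨s, t, hs, ht, h0, h1, -⟩ := exists_rep_of_mem_typeSet hN hv
  have hcop : ∀ m : ℕ, ¬ p ∣ m → IsCoprime (p : ℤ) m := fun m hm =>
    Nat.isCoprime_iff_coprime.2 ((hp.coprime_iff_not_dvd).2 hm)
  have e0 : ((p : ZMod N) • v) 0 = p * v 0 := rfl
  have e1 : ((p : ZMod N) • v) 1 = p * v 1 := rfl
  by_cases hA : p ∣ A
  · obtain ⟨A', rfl⟩ := hA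
    refine Or.inl ⟨A', rfl, (mem_typeSet_of_rep (A := A') (by rw [hN]; ring) (s := s) (t := t)
      ?_ ht ?_ ?_).1⟩
    · push_cast at hs; exact hs.of_mul_right_right
    · rw [e0, h0]; push_cast; ring
    · rw [e1, h1]; push_cast; ring
  right
  by_cases hB : p ∣ B
  · obtain ⟨B', rfl⟩ := hB
    refine Or.inl ⟨hA, B', rfl, (mem_typeSet_of_rep (A := A) (by rw [hN]; ring) (s := p * s)
      (t := t) ((hcop _ hA).mul_left hs) ?_ ?_ ?_).1⟩
    · push_cast at ht; exact ht.of_mul_right_right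
    · rw [e0, h0]; push_cast; ring
    · rw [e1, h1]; push_cast; ring
  · refine Or.inr ⟨hA, hB, (mem_typeSet_of_rep (A := A) hN (s := p * s)
      (t := p * t) ((hcop _ hA).mul_left hs) ((hcop _ hB).mul_left ht) ?_ ?_).1⟩
    · rw [e0, h0]; push_cast; ring
    · rw [e1, h1]; push_cast; ring

theorem comp_smul_mem_invariantFunctions {N : ℕ} {Γ : Subgroup SL(2, ℤ)} {f : ZVec N → ℂ}
    (hf : f ∈ invariantFunctions N Γ) (a : ZMod N) :
    (fun v => f (a • v)) ∈ invariantFunctions N Γ := by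
  rw [mem_invariantFunctions_iff] at hf ⊢
  intro γ hγ v
  rw [← rowAct_smul, hf γ hγ]

theorem mem_cuspOrbit_iff {N : ℕ} {d : ℕ} (hd : d ∣ N) (u : (ZMod (Nat.gcd d (N / d)))ˣ) (v : ZVec N) :
    v ∈ cuspOrbit N d u ↔ v ∈ typeSet N d (N / d / Nat.gcd d (N / d)) ∧
      ((typeInv d (N / d / Nat.gcd d (N / d)) v : ℕ) : ZMod (Nat.gcd d (N / d))) = u := by
  have h1 : N / Nat.gcd d (N / d) = d * (N / d / Nat.gcd d (N / d)) := by
    rw [← Nat.mul_div_assoc d (Nat.gcd_dvd_right _ _), Nat.mul_div_cancel' hd]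
  unfold cuspOrbit tripleOrbit
  rw [h1]
  exact (and_assoc (c := ((typeInv d (N / d / Nat.gcd d (N / d)) v : ℕ) :
    ZMod (Nat.gcd d (N / d))) = u)).symm

/-- This gives the type of the orbits of the theorem: A = g, B = d, D = (N/d)/g. Here A ∣ B, and B/A
= d/g is prime to D. -/
theorem eq_gcd_mul {N : ℕ} {d : ℕ} (hd : d ∣ N) :
    N = Nat.gcd d (N / d) * d * (N / d / Nat.gcd d (N / d)) := by
  have h1 : Nat.gcd d (N / d) * (N / d / Nat.gcd d (N / d)) = N / d :=
    Nat.mul_div_cancel' (Nat.gcd_dvd_right _ _)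
  calc N = d * (N / d) := (Nat.mul_div_cancel' hd).symm
    _ = d * (Nat.gcd d (N / d) * (N / d / Nat.gcd d (N / d))) := by rw [h1]
    _ = _ := by ring

/-! ### Spanning by the distribution relations -/

section Span

variable {N : ℕ} [NeZero N] {X : Type*} [AddCommGroup X] [Module ℂ X]

/-- `L` sends every `Γ₀(N)`-invariant function supported on `typeSet N B D` into `S`. -/
def TypeMapsTo (L : (ZVec N → ℂ) →ₗ[ℂ] X) (S : Submodule ℂ X) (B D : ℕ) : Prop :=
  ∀ f ∈ invariantFunctions N (CongruenceSubgroup.Gamma0 N),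
    (∀ v, f v ≠ 0 → v ∈ typeSet N B D) → L f ∈ S

theorem indicator_typeSet_mem_invariantFunctions {A B D : ℕ} (hN : N = A * B * D)
    {f : ZVec N → ℂ} (hf : f ∈ invariantFunctions N (CongruenceSubgroup.Gamma0 N)) :
    (typeSet N B D).indicator f ∈ invariantFunctions N (CongruenceSubgroup.Gamma0 N) := by
  classical
  rw [mem_invariantFunctions_iff] at hf ⊢
  intro γ hγ v
  have hiff : rowAct v γ ∈ typeSet N B D ↔ v ∈ typeSet N B D := by
    refine ⟨fun h => ?_, fun h => (rowAct_gamma0_mem_typeSet hN h hγ).1⟩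
    have := (rowAct_gamma0_mem_typeSet hN h (inv_mem hγ)).1
    rwa [rowAct_inv_rowAct] at this
  simp only [Set.indicator_apply, hiff, hf γ hγ]

theorem mem_of_forall_type (L : (ZVec N → ℂ) →ₗ[ℂ] X) (S : Submodule ℂ X) {f : ZVec N → ℂ}
    (hf : f ∈ invariantFunctions N (CongruenceSubgroup.Gamma0 N))
    (h : ∀ v A B D, f v ≠ 0 → N = A * B * D → v ∈ typeSet N B D → TypeMapsTo L S B D) :
    L f ∈ S := by
  classical
  set T := ((N.divisors ×ˢ N.divisors) ×ˢ N.divisors).filter fun τ => N = τ.1.1 * τ.1.2 * τ.2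
    with hT
  have hsum : f = ∑ τ ∈ T, (typeSet N τ.1.2 τ.2).indicator f := by
    ext v
    obtain ⟨A, B, D, hN, hv⟩ := exists_mem_typeSet N v
    rw [Finset.sum_apply, Finset.sum_eq_single ((A, B), D)]
    · rw [Set.indicator_of_mem hv]
    · rintro ⟨⟨A', B'⟩, D'⟩ hτ hne
      refine Set.indicator_of_notMem (fun hv' => hne ?_) f
      obtain ⟨rfl, rfl, rfl⟩ := typeSet_unique hN (Finset.mem_filter.1 hτ).2 hv hv'
      rfl
    · intro hτ
      refine absurd ?_ hτ
      rw [hT, Finset.mem_filter]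
      simp only [Finset.mem_product, Nat.mem_divisors]
      have := NeZero.ne N
      exact ⟨⟨⟨⟨⟨B * D, by rw [hN]; ring⟩, this⟩, ⟨A * D, by rw [hN]; ring⟩, this⟩,
        ⟨A * B, by rw [hN]; ring⟩, this⟩, hN⟩
  rw [hsum, map_sum]
  refine Submodule.sum_mem _ fun τ hτ => ?_
  have hN := (Finset.mem_filter.1 hτ).2
  by_cases h0 : ∃ v, f v ≠ 0 ∧ v ∈ typeSet N τ.1.2 τ.2
  · obtain ⟨v, hfv, hv⟩ := h0
    refine h v _ _ _ hfv hN hv _ (indicator_typeSet_mem_invariantFunctions hN hf) fun w hw => ?_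
    by_contra hc
    exact hw (Set.indicator_of_notMem hc f)
  · have : (typeSet N τ.1.2 τ.2).indicator f = 0 := by
      ext v
      by_cases hv : v ∈ typeSet N τ.1.2 τ.2
      · rw [Set.indicator_of_mem hv]
        by_contra hc
        exact h0 ⟨v, hc, hv⟩
      · rw [Set.indicator_of_notMem hv]; rfl
    rw [this, map_zero]
    exact S.zero_mem

theorem exists_smul_of_mem_typeSet {A B D p : ℕ} (hN : N = A * B * (p * D)) {w : ZVec N}
    (hw : w ∈ typeSet N B (p * D)) : ∃ v, (p : ZMod N) • v = w := by
  obtain ⟨s, t, -, -, h0, h1, -⟩ := exists_rep_of_mem_typeSet hN hw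
  refine ⟨![((B * D * s : ℤ) : ZMod N), ((D * t : ℤ) : ZMod N)], ?_⟩
  ext i
  fin_cases i
  · change (p : ZMod N) * ((B * D * s : ℤ) : ZMod N) = w 0
    rw [h0]; push_cast; ring
  · change (p : ZMod N) * ((D * t : ℤ) : ZMod N) = w 1
    rw [h1]; push_cast; ring

variable {k : ℕ} {L : (ZVec N → ℂ) →ₗ[ℂ] X} {S : Submodule ℂ X}

/-- The types of the vectors `v` for which `p • v` has a given type. -/
theorem type_of_smul_mem {A B D p A' B' D' : ℕ} (hp : p.Prime) (hN : N = A * B * (p * D))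
    (hN' : N = A' * B' * D') {v : ZVec N} (hv : v ∈ typeSet N B' D')
    (hpv : (p : ZMod N) • v ∈ typeSet N B (p * D)) :
    (A' = p * A ∧ B' = B ∧ D' = D) ∨ (¬ p ∣ A ∧ A' = A ∧ B' = p * B ∧ D' = D) ∨
      (¬ p ∣ A ∧ ¬ p ∣ B ∧ A' = A ∧ B' = B ∧ D' = p * D) := by
  rcases smul_mem_typeSet hp hN' hv with ⟨A₁, hA₁, h⟩ | ⟨hA, B₁, hB₁, h⟩ | ⟨hA, hB, h⟩
  · obtain ⟨h1, h2, h3⟩ := typeSet_unique hN (A' := A₁) (by rw [hN', hA₁]; ring) hpv h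
    left
    exact ⟨by rw [hA₁, h1], h2.symm, Nat.eq_of_mul_eq_mul_left hp.pos h3.symm⟩
  · obtain ⟨h1, h2, h3⟩ := typeSet_unique hN (A' := A') (by rw [hN', hB₁]; ring) hpv h
    right; left
    exact ⟨h1 ▸ hA, h1.symm, by rw [hB₁, h2], Nat.eq_of_mul_eq_mul_left hp.pos h3.symm⟩
  · obtain ⟨h1, h2, h3⟩ := typeSet_unique hN hN' hpv h
    right; right
    exact ⟨h1 ▸ hA, h2 ▸ hB, h1.symm, h2.symm, h3.symm⟩

/-- As f lives on multiples of p, L f is a scalar multiple of L(f(p·)). The support of f(p·) meets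
only the types (pA, B, D) and, if p ∤ A, (A, pB, D); the condition on p keeps the type of f itself
from recurring. -/
theorem TypeMapsTo.of_dilate (hL : SatisfiesDistribution k L) {A B D p : ℕ} (hp : p.Prime)
    (hN : N = A * B * (p * D)) (hpAB : p ∣ A ∨ p ∣ B) (h1 : TypeMapsTo L S B D)
    (h2 : ¬ p ∣ A → TypeMapsTo L S (p * B) D) : TypeMapsTo L S B (p * D) := by
  intro f hf hsupp
  have hpN : p ∣ N := ⟨A * B * D, by rw [hN]; ring⟩
  have hpC : (p : ℂ) ≠ 0 := by exact_mod_cast hp.ne_zero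
  have hrel := hL p hp hpN f fun w hw => by
    by_contra h
    exact hw (exists_smul_of_mem_typeSet hN (hsupp w h))
  have hmem : L (fun v => f ((p : ZMod N) • v)) ∈ S := by
    refine mem_of_forall_type L S (comp_smul_mem_invariantFunctions hf _) ?_
    intro v A' B' D' hv hN' hvT
    rcases type_of_smul_mem hp hN hN' hvT (hsupp _ hv) with
      ⟨-, rfl, rfl⟩ | ⟨hA, -, rfl, rfl⟩ | ⟨hA, hB, -⟩
    · exact h1
    · exact h2 hA
    · exact absurd hpAB (by tauto)
  have h3 : (p : ℂ) ^ 2 • L f ∈ S := hrel ▸ S.smul_mem _ hmem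
  exact (S.smul_mem_iff (pow_ne_zero 2 hpC)).1 h3

/-- The gcd condition lets f descend along v ↦ pv to some g of type (A, B, pD). Then L f is
L(g(p·)), a multiple of L g, minus the contribution of the other types met by g(p·), where pA has
been replaced by A. -/
theorem TypeMapsTo.of_contract (hL : SatisfiesDistribution k L) {A B D p : ℕ} (hp : p.Prime)
    (hN : N = (p * A) * B * D) (hgcd : Nat.gcd (p * A) B ∣ A)
    (h1 : TypeMapsTo L S B (p * D)) (h2 : ¬ p ∣ A → TypeMapsTo L S (p * B) D) :
    TypeMapsTo L S B D := by
  classical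
  intro f hf hsupp
  have hinv := mem_invariantFunctions_iff.1 hf
  have hpN : p ∣ N := ⟨A * B * D, by rw [hN]; ring⟩
  have hpC : (p : ℂ) ≠ 0 := by exact_mod_cast hp.ne_zero
  have hN2 : N = A * B * (p * D) := by rw [hN]; ring
  have hN0 : p * A * B * D ≠ 0 := hN ▸ NeZero.ne N
  -- Equality of pv and pw fixes s mod A and t mod AB, hence st mod gcd(pA, B), which divides A. So
  -- v and w lie in one orbit.
  have hwell : ∀ v w : ZVec N, v ∈ typeSet N B D → w ∈ typeSet N B D →
      (p : ZMod N) • v = (p : ZMod N) • w → f v = f w := by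
    intro v w hv hw hvw
    obtain ⟨s, t, hs, ht, hv0, hv1, hst⟩ := exists_rep_of_mem_typeSet hN hv
    obtain ⟨s', t', hs', ht', hw0, hw1, hst'⟩ := exists_rep_of_mem_typeSet hN hw
    have hNZ : (N : ℤ) = p * A * B * D := by rw [hN]; push_cast; rfl
    have hpZ : (p : ℤ) ≠ 0 := by exact_mod_cast hp.ne_zero
    have hDZ : (D : ℤ) ≠ 0 := by exact_mod_cast right_ne_zero_of_mul hN0
    have hBZ : (B : ℤ) ≠ 0 := by
      exact_mod_cast right_ne_zero_of_mul (left_ne_zero_of_mul hN0)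
    have e0 : (A : ℤ) ∣ s' - s := by
      have := congrFun hvw 0
      simp only [Pi.smul_apply, smul_eq_mul] at this
      rw [hv0, hw0, ← Int.cast_natCast (R := ZMod N) p, ← Int.cast_mul, ← Int.cast_mul,
        ZMod.intCast_eq_intCast_iff_dvd_sub, hNZ] at this
      have e : (p : ℤ) * (B * D * s') - p * (B * D * s) = (p * B * D) * (s' - s) := by ring
      rw [e, show (p * A * B * D : ℤ) = (p * B * D) * A by ring] at this
      exact Int.dvd_of_mul_dvd_mul_left (by positivity) this
    have e1 : (A * B : ℤ) ∣ t' - t := by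
      have := congrFun hvw 1
      simp only [Pi.smul_apply, smul_eq_mul] at this
      rw [hv1, hw1, ← Int.cast_natCast (R := ZMod N) p, ← Int.cast_mul, ← Int.cast_mul,
        ZMod.intCast_eq_intCast_iff_dvd_sub, hNZ] at this
      have e : (p : ℤ) * (D * t') - p * (D * t) = (p * D) * (t' - t) := by ring
      rw [e, show (p * A * B * D : ℤ) = (p * D) * (A * B) by ring] at this
      exact Int.dvd_of_mul_dvd_mul_left (by positivity) this
    have hg : ((Nat.gcd (p * A) B : ℕ) : ℤ) ∣ A := Int.natCast_dvd_natCast.2 hgcd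
    obtain ⟨γ, hγ, rfl⟩ := exists_gamma0_of_typeInv hN hw hv (by
      rw [hst, hst', show s' * t' - s * t = (s' - s) * t' + s * (t' - t) by ring]
      exact ((hg.trans e0).mul_right _).add (((hg.trans (Dvd.intro _ rfl)).trans e1).mul_left _))
    exact hinv γ hγ w
  let g : ZVec N → ℂ := fun w =>
    if h : ∃ v, v ∈ typeSet N B D ∧ (p : ZMod N) • v = w then f h.choose else 0
  have hg_smul : ∀ v ∈ typeSet N B D, g ((p : ZMod N) • v) = f v := by
    intro v hv
    have hex : ∃ v', v' ∈ typeSet N B D ∧ (p : ZMod N) • v' = (p : ZMod N) • v := ⟨v, hv, rfl⟩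
    simp only [g]
    rw [dif_pos hex]
    exact hwell _ _ hex.choose_spec.1 hv hex.choose_spec.2
  have hg_ne : ∀ w, g w ≠ 0 → ∃ v, v ∈ typeSet N B D ∧ (p : ZMod N) • v = w := by
    intro w hw
    by_contra h
    exact hw (dif_neg h)
  have hginv : g ∈ invariantFunctions N (CongruenceSubgroup.Gamma0 N) := by
    rw [mem_invariantFunctions_iff]
    intro γ hγ w
    by_cases h : ∃ v, v ∈ typeSet N B D ∧ (p : ZMod N) • v = w
    · obtain ⟨v, hv, rfl⟩ := h
      rw [rowAct_smul, hg_smul _ (rowAct_gamma0_mem_typeSet hN hv hγ).1, hg_smul v hv,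
        hinv γ hγ]
    · have h' : ¬ ∃ v, v ∈ typeSet N B D ∧ (p : ZMod N) • v = rowAct w γ := by
        rintro ⟨v, hv, hvw⟩
        refine h ⟨rowAct v γ⁻¹, (rowAct_gamma0_mem_typeSet hN hv (inv_mem hγ)).1, ?_⟩
        rw [← rowAct_smul, hvw, rowAct_inv_rowAct]
      simp only [g, dif_neg h, dif_neg h']
  have hg_supp : ∀ w, g w ≠ 0 → w ∈ typeSet N B (p * D) := by
    intro w hw
    obtain ⟨v, hv, rfl⟩ := hg_ne w hw
    rcases smul_mem_typeSet hp hN hv with ⟨_, _, h⟩ | ⟨h, _⟩ | ⟨h, _⟩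
    · exact h
    · exact absurd (Dvd.intro _ rfl) h
    · exact absurd (Dvd.intro _ rfl) h
  have hrel := hL p hp hpN g fun w hw => by
    by_contra h
    obtain ⟨v, -, hv⟩ := hg_ne w h
    exact hw ⟨v, hv⟩
  have hgS : L (fun v => g ((p : ZMod N) • v)) ∈ S := by
    refine (S.smul_mem_iff (pow_ne_zero k hpC)).1 ?_
    rw [hrel]
    exact S.smul_mem _ (h1 g hginv hg_supp)
  have hdiff : L ((fun v => g ((p : ZMod N) • v)) - f) ∈ S := by
    refine mem_of_forall_type L S (sub_mem (comp_smul_mem_invariantFunctions hginv _) hf) ?_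
    intro v A' B' D' hv hN' hvT
    by_cases hvm : v ∈ typeSet N B D
    · exact absurd (by simp [hg_smul v hvm]) hv
    · have hf0 : f v = 0 := by
        by_contra h
        exact hvm (hsupp v h)
      have hgv : g ((p : ZMod N) • v) ≠ 0 := by
        simpa [hf0] using hv
      rcases type_of_smul_mem hp hN2 hN' hvT (hg_supp _ hgv) with
        ⟨-, rfl, rfl⟩ | ⟨hA, -, rfl, rfl⟩ | ⟨hA, hB, -, rfl, rfl⟩
      · exact absurd hvT hvm
      · exact h2 hA
      · exact h1
  rw [map_sub] at hdiff
  have := S.sub_mem hgS hdiff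
  rwa [sub_sub_cancel] at this

theorem cuspOrbit_eq_rowOrbit {d : ℕ} (hd : d ∣ N) (u : (ZMod (Nat.gcd d (N / d)))ˣ) :
    ∃ v : ZVec N, v ∈ cuspOrbit N d u ∧
      cuspOrbit N d u = rowOrbit (CongruenceSubgroup.Gamma0 N) v := by
  have h1 : N / Nat.gcd d (N / d) = d * (N / d / Nat.gcd d (N / d)) := by
    rw [← Nat.mul_div_assoc d (Nat.gcd_dvd_right _ _), Nat.mul_div_cancel' hd]
  have hg : Nat.gcd d (N / d) = Nat.gcd (Nat.gcd d (N / d)) d :=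
    (Nat.gcd_eq_left (Nat.gcd_dvd_left _ _)).symm
  unfold cuspOrbit
  rw [h1]
  obtain ⟨v, hv⟩ := tripleOrbit_nonempty (eq_gcd_mul hd) hg u
  exact ⟨v, hv, tripleOrbit_eq_rowOrbit (eq_gcd_mul hd) hg u hv⟩

theorem typeMapsTo_cusp {d : ℕ} (hd : d ∣ N)
    (hS : ∀ u : (ZMod (Nat.gcd d (N / d)))ˣ, L (indicatorFun (cuspOrbit N d u)) ∈ S) :
    TypeMapsTo L S d (N / d / Nat.gcd d (N / d)) := by
  classical
  intro f hf hsupp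
  have hinv := mem_invariantFunctions_iff.1 hf
  set g := Nat.gcd d (N / d) with hgdef
  have hg0 : g ≠ 0 := fun h => NeZero.ne N (by rw [eq_gcd_mul hd, ← hgdef, h]; simp)
  have : NeZero g := ⟨hg0⟩
  choose w hw hworb using fun u : (ZMod g)ˣ => cuspOrbit_eq_rowOrbit hd u
  have hsum : f = ∑ u : (ZMod g)ˣ, f (w u) • indicatorFun (cuspOrbit N d u) := by
    ext v
    rw [Finset.sum_apply]
    by_cases hv : v ∈ typeSet N d (N / d / g)
    · have hcop := typeInv_isCoprime (eq_gcd_mul hd) hv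
      rw [← hgdef, Nat.gcd_eq_left (show g ∣ d from Nat.gcd_dvd_left _ _)] at hcop
      have hu : v ∈ cuspOrbit N d (ZMod.unitOfIsCoprime _ hcop) := by
        refine (mem_cuspOrbit_iff hd _ v).2 ⟨hv, ?_⟩
        rw [ZMod.coe_unitOfIsCoprime, Int.cast_natCast]
      rw [Finset.sum_eq_single (ZMod.unitOfIsCoprime _ hcop)]
      · have h2 := hu
        rw [hworb] at h2
        obtain ⟨γ, hγ, hvγ⟩ := h2
        rw [Pi.smul_apply, indicatorFun, Set.indicator_of_mem hu, smul_eq_mul, mul_one]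
        exact (congrArg f hvγ).trans (hinv γ hγ _)
      · intro u _ hne
        rw [Pi.smul_apply, indicatorFun, Set.indicator_of_notMem, smul_zero]
        intro hv'
        refine hne (Units.ext ?_)
        rw [← ((mem_cuspOrbit_iff hd _ v).1 hv').2, ((mem_cuspOrbit_iff hd _ v).1 hu).2]
      · simp
    · rw [Finset.sum_eq_zero]
      · by_contra h
        exact hv (hsupp v h)
      · intro u _
        rw [Pi.smul_apply, indicatorFun, Set.indicator_of_notMem, smul_zero]
        exact fun hv' => hv ((mem_cuspOrbit_iff hd _ v).1 hv').1
  rw [hsum, map_sum]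
  refine Submodule.sum_mem _ fun u _ => ?_
  rw [map_smul]
  exact S.smul_mem _ (hS u)

/-- Induction on D. If b = B/A is prime to D, the type is one of those in the theorem. Otherwise a
common prime p of b and D is moved out of D; both resulting types keep the divisibility, pA ∣ B
because p ∣ b, and A ∣ pB. -/
theorem typeMapsTo_of_dvd (hL : SatisfiesDistribution k L)
    (hS : ∀ f ∈ orbitIndicators N, L f ∈ S) :
    ∀ D A B : ℕ, N = A * B * D → A ∣ B → TypeMapsTo L S B D := by
  intro D
  induction D using Nat.strong_induction_on with
  | _ D ih =>
    rintro A B hN ⟨b, rfl⟩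
    have hN0 : A * (A * b) * D ≠ 0 := hN ▸ NeZero.ne N
    have hD0 : D ≠ 0 := right_ne_zero_of_mul hN0
    have hA0 : A ≠ 0 := left_ne_zero_of_mul (left_ne_zero_of_mul hN0)
    have hB0 : A * b ≠ 0 := right_ne_zero_of_mul (left_ne_zero_of_mul hN0)
    by_cases hcop : Nat.Coprime b D
    · have hd : A * b ∣ N := ⟨A * D, by rw [hN]; ring⟩
      have hdiv : N / (A * b) = A * D :=
        Nat.div_eq_of_eq_mul_right (Nat.pos_of_ne_zero hB0) (by rw [hN]; ring)
      have hg : Nat.gcd (A * b) (N / (A * b)) = A := by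
        rw [hdiv, Nat.gcd_mul_left, hcop, mul_one]
      have hq : N / (A * b) / Nat.gcd (A * b) (N / (A * b)) = D := by
        rw [hg, hdiv, Nat.mul_div_cancel_left _ (Nat.pos_of_ne_zero hA0)]
      have := typeMapsTo_cusp (L := L) (S := S) hd fun u => hS _ ⟨_, hd, u, rfl⟩
      rwa [hq] at this
    · obtain ⟨p, hp, hpb, hpD⟩ := Nat.Prime.not_coprime_iff_dvd.1 hcop
      obtain ⟨D', rfl⟩ := hpD
      obtain ⟨b', rfl⟩ := hpb
      have hlt : D' < p * D' := by
        have : D' ≠ 0 := right_ne_zero_of_mul hD0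
        have := hp.two_le
        nlinarith [Nat.pos_of_ne_zero ‹D' ≠ 0›]
      refine TypeMapsTo.of_dilate hL hp hN (Or.inr ⟨A * b', by ring⟩) ?_ fun _ => ?_
      · exact ih D' hlt (p * A) _ (by rw [hN]; ring) ⟨b', by ring⟩
      · exact ih D' hlt A _ (by rw [hN]; ring) ⟨p * (p * b'), by ring⟩

/-- Induction on A. If A ∤ B, a prime p dividing A/gcd(A,B) can be removed from A with gcd(A,B)
still dividing A/p, which is what contraction requires. -/
theorem typeMapsTo_of_orbitIndicators (hL : SatisfiesDistribution k L)
    (hS : ∀ f ∈ orbitIndicators N, L f ∈ S) :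
    ∀ A B D : ℕ, N = A * B * D → TypeMapsTo L S B D := by
  intro A
  induction A using Nat.strong_induction_on with
  | _ A ih =>
    intro B D hN
    by_cases hAB : A ∣ B
    · exact typeMapsTo_of_dvd hL hS D A B hN hAB
    have hN0 : A * B * D ≠ 0 := hN ▸ NeZero.ne N
    have hA0 : A ≠ 0 := left_ne_zero_of_mul (left_ne_zero_of_mul hN0)
    obtain ⟨m, hm⟩ := Nat.gcd_dvd_left A B
    have hm1 : m ≠ 1 := by
      rintro rfl
      rw [mul_one] at hm
      exact hAB (hm ▸ Nat.gcd_dvd_right A B)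
    obtain ⟨p, hp, m', rfl⟩ := Nat.exists_prime_and_dvd hm1
    have hA : A = p * (Nat.gcd A B * m') := by
      conv_lhs => rw [hm]
      ring
    set A' := Nat.gcd A B * m' with hA'
    have hgcd : Nat.gcd A B ∣ A' := Dvd.intro _ rfl
    have hA'0 : A' ≠ 0 := fun h => hA0 (by rw [hA, h, mul_zero])
    have hlt : A' < A := by
      have := hp.two_le
      have := Nat.pos_of_ne_zero hA'0
      nlinarith
    refine TypeMapsTo.of_contract hL hp (A := A') (by rw [← hA]; exact hN)
      (by rw [← hA]; exact hgcd) ?_ fun _ => ?_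
    · exact ih A' hlt _ _ (by rw [hN, hA]; ring)
    · exact ih A' hlt _ _ (by rw [hN, hA]; ring)

theorem map_mem_of_orbitIndicators (hL : SatisfiesDistribution k L)
    (hS : ∀ f ∈ orbitIndicators N, L f ∈ S) {f : ZVec N → ℂ}
    (hf : f ∈ invariantFunctions N (CongruenceSubgroup.Gamma0 N)) : L f ∈ S :=
  mem_of_forall_type L S hf fun _ A B D _ hN _ => typeMapsTo_of_orbitIndicators hL hS A B D hN

end Span

/-! ### Linear independence and the basis -/

theorem indicatorFun_rowOrbit_mem {N : ℕ} {Γ : Subgroup SL(2, ℤ)} (v : ZVec N) :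
    indicatorFun (rowOrbit Γ v) ∈ invariantFunctions N Γ := by
  classical
  rw [mem_invariantFunctions_iff]
  intro γ hγ w
  have hiff : rowAct w γ ∈ rowOrbit Γ v ↔ w ∈ rowOrbit Γ v := by
    constructor
    · rintro ⟨δ, hδ, h⟩
      refine ⟨δ * γ⁻¹, mul_mem hδ (inv_mem hγ), ?_⟩
      rw [rowAct_mul, ← h, rowAct_inv_rowAct]
    · rintro ⟨δ, hδ, rfl⟩
      exact ⟨δ * γ, mul_mem hδ hγ, by rw [rowAct_mul]⟩
  simp only [indicatorFun, Set.indicator_apply, hiff]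

theorem apply_neg_of_mem_invariantFunctions {N : ℕ} {F : ZVec N → ℂ}
    (hF : F ∈ invariantFunctions N (CongruenceSubgroup.Gamma0 N)) (v : ZVec N) :
    F (-v) = F v := by
  have hmem : (-1 : SL(2, ℤ)) ∈ CongruenceSubgroup.Gamma0 N := by
    rw [CongruenceSubgroup.Gamma0_mem]; simp
  have hact : rowAct v (-1 : SL(2, ℤ)) = -v := by
    ext i
    fin_cases i
    · simp [rowAct_zero_apply]
    · simp [rowAct_one_apply]
  rw [← hact, mem_invariantFunctions_iff.1 hF _ hmem]

theorem eq_singleton_of_zero_mem_rowOrbit {N : ℕ} {Γ : Subgroup SL(2, ℤ)} {v : ZVec N}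
    (h : 0 ∈ rowOrbit Γ v) : rowOrbit Γ v = {0} := by
  obtain ⟨γ, hγ, h0⟩ := h
  have hv : v = 0 := by
    rw [← rowAct_inv_rowAct v γ, ← h0, rowAct_zero]
  subst hv
  ext w
  constructor
  · rintro ⟨δ, -, rfl⟩
    exact rowAct_zero δ
  · rintro rfl
    exact ⟨1, one_mem _, (rowAct_one _).symm⟩

/-- The indices of the orbits `[N / g, (N/d) / g, u]`. -/
abbrev CuspIndex (N : ℕ) : Type := Σ d : N.divisors, (ZMod (Nat.gcd d (N / d)))ˣ

instance finite_cuspIndex (N : ℕ) [NeZero N] : Finite (CuspIndex N) := by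
  have (d : N.divisors) : Finite (ZMod (Nat.gcd d (N / d)))ˣ := by
    have : NeZero (Nat.gcd (d : ℕ) (N / d)) :=
      ⟨(Nat.gcd_pos_of_pos_left _ (Nat.pos_of_mem_divisors d.2)).ne'⟩
    infer_instance
  infer_instance

/-- The orbit `[N / d, 1, u]` of vectors of exact order `N`. -/
def primitiveOrbit (N d : ℕ) (u : (ZMod (Nat.gcd d (N / d)))ˣ) : Set (ZVec N) :=
  tripleOrbit N (N / d * 1) 1 u

theorem primitiveOrbit_eq_rowOrbit {N d : ℕ} [NeZero N] (hd : d ∣ N)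
    (u : (ZMod (Nat.gcd d (N / d)))ˣ) : ∃ v : ZVec N, v ∈ primitiveOrbit N d u ∧
      primitiveOrbit N d u = rowOrbit (CongruenceSubgroup.Gamma0 N) v := by
  have hN : N = d * (N / d) * 1 := by rw [mul_one, Nat.mul_div_cancel' hd]
  obtain ⟨v, hv⟩ := tripleOrbit_nonempty hN rfl u
  exact ⟨v, hv, tripleOrbit_eq_rowOrbit hN rfl u hv⟩

theorem primitiveOrbit_index_unique {N : ℕ} [NeZero N] {i j : CuspIndex N} {v : ZVec N}
    (hi : v ∈ primitiveOrbit N i.1 i.2) (hj : v ∈ primitiveOrbit N j.1 j.2) : i = j := by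
  obtain ⟨⟨d, hd⟩, u⟩ := i
  obtain ⟨⟨d', hd'⟩, u'⟩ := j
  have h1 : N / d = N / d' := by
    have := hi.1.symm.trans hj.1
    simpa using this
  have h2 : d = d' := by
    rw [← Nat.div_div_self (Nat.dvd_of_mem_divisors hd) (NeZero.ne N), h1,
      Nat.div_div_self (Nat.dvd_of_mem_divisors hd') (NeZero.ne N)]
  subst h2
  have h3 : u = u' := Units.ext (hi.2.2.symm.trans hj.2.2)
  rw [h3]

/-- Fourier inversion turns a linear relation into E_{k,F} = 0 for a combination F of indicators of
disjoint orbits. F is supported on vectors of order N, and even since -1 ∈ Γ₀(N), so F = 0. -/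
theorem linearIndependent_eisLinear_primitiveOrbit {N k : ℕ} [NeZero N] (hk : 2 ≤ k)
    (hke : Even k) : LinearIndependent ℂ fun i : CuspIndex N =>
      eisLinear hk (fourierTransform (indicatorFun (primitiveOrbit N i.1 i.2))) := by
  classical
  have := Fintype.ofFinite (CuspIndex N)
  rw [Fintype.linearIndependent_iff]
  intro a ha i
  set F : ZVec N → ℂ := ∑ j : CuspIndex N, a j • indicatorFun (primitiveOrbit N j.1 j.2) with hF
  have h1 : eisLinear hk (fourierTransform F) = 0 := by
    rw [← ha]
    change eisLinear hk (fourierLinear F) = ∑ j : CuspIndex N, a j •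
      eisLinear hk (fourierLinear (indicatorFun (primitiveOrbit N j.1 j.2)))
    simp only [hF, map_sum, map_smul]
  rw [eisLinear_eq_zero_iff, fourierTransform_fourierTransform] at h1
  have hinv : F ∈ invariantFunctions N (CongruenceSubgroup.Gamma0 N) := by
    refine Submodule.sum_mem _ fun j _ => Submodule.smul_mem _ _ ?_
    obtain ⟨v, -, hv⟩ := primitiveOrbit_eq_rowOrbit (Nat.dvd_of_mem_divisors j.1.2) j.2
    rw [hv]
    exact indicatorFun_rowOrbit_mem v
  have hF0 : F = 0 := by
    refine eq_zero_of_eisensteinE_eq_zero hk hke F (apply_neg_of_mem_invariantFunctions hinv)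
      (fun v hv => ?_) h1
    rw [hF, Finset.sum_apply] at hv
    obtain ⟨j, -, hj⟩ := Finset.exists_ne_zero_of_sum_ne_zero hv
    have hvj : v ∈ primitiveOrbit N j.1 j.2 := by
      by_contra h
      refine hj ?_
      rw [Pi.smul_apply, indicatorFun, Set.indicator_of_notMem h, smul_zero]
    rw [hvj.1, Nat.gcd_comm]
    exact hvj.2.1
  obtain ⟨v, hv, -⟩ := primitiveOrbit_eq_rowOrbit (Nat.dvd_of_mem_divisors i.1.2) i.2
  have h2 := congrFun hF0 v
  rw [hF, Finset.sum_apply, Finset.sum_eq_single i] at h2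
  · rw [Pi.smul_apply, indicatorFun, Set.indicator_of_mem hv] at h2
    simpa using h2
  · intro j _ hji
    rw [Pi.smul_apply, indicatorFun, Set.indicator_of_notMem, smul_zero]
    exact fun hj => hji (primitiveOrbit_index_unique hj hv)
  · simp

theorem LinearIndependent.of_mem_span_range {K V ι : Type*} [Field K] [AddCommGroup V] [Module K V]
    [Finite ι] {b c : ι → V} (hc : LinearIndependent K c)
    (h : ∀ i, c i ∈ Submodule.span K (Set.range b)) : LinearIndependent K b := by
  have := Fintype.ofFinite ι
  rw [linearIndependent_iff_card_le_finrank_span]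
  have hfin : FiniteDimensional K (Submodule.span K (Set.range b)) :=
    FiniteDimensional.span_of_finite K (Set.finite_range b)
  calc Fintype.card ι = (Set.range c).finrank K :=
        linearIndependent_iff_card_eq_finrank_span.1 hc
    _ ≤ (Set.range b).finrank K :=
        Submodule.finrank_mono (Submodule.span_le.2 (Set.range_subset_iff.2 h))

/-- By the spanning argument the independent family on primitive orbits lies in the span of this
one, and the two have the same finite index set. -/
theorem linearIndependent_eisLinear_cuspOrbit {N k : ℕ} [NeZero N] (hk : 2 ≤ k)
    (hke : Even k) : LinearIndependent ℂ fun i : CuspIndex N =>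
      eisLinear hk (indicatorFun (cuspOrbit N i.1 i.2)) := by
  refine (linearIndependent_eisLinear_primitiveOrbit hk hke).of_mem_span_range fun i => ?_
  refine map_mem_of_orbitIndicators (satisfiesDistribution_eisLinear hk) ?_ ?_
  · rintro f ⟨d, hd, u, rfl⟩
    exact Submodule.subset_span ⟨⟨⟨d, Nat.mem_divisors.2 ⟨hd, NeZero.ne N⟩⟩, u⟩, rfl⟩
  · refine fourierTransform_mem_invariantFunctions ?_
    obtain ⟨v, -, hv⟩ := primitiveOrbit_eq_rowOrbit (Nat.dvd_of_mem_divisors i.1.2) i.2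
    rw [hv]
    exact indicatorFun_rowOrbit_mem v

theorem linearIndependent_eisMap_basisFunctions {N k : ℕ} [NeZero N] (hk : 2 ≤ k)
    (hke : Even k) :
    LinearIndependent ℂ (fun f : basisFunctions N k => eisMap k (f : ZVec N → ℂ)) := by
  have hex : ∀ f : basisFunctions N k, ∃ i : CuspIndex N,
      (f : ZVec N → ℂ) = indicatorFun (cuspOrbit N i.1 i.2) := by
    rintro ⟨f, ⟨d, hd, u, hf⟩, -⟩
    exact ⟨⟨⟨d, Nat.mem_divisors.2 ⟨hd, NeZero.ne N⟩⟩, u⟩, hf⟩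
  choose i hi using hex
  have hinj : Function.Injective i := by
    intro f g hfg
    exact Subtype.ext (by rw [hi f, hi g, hfg])
  convert (linearIndependent_eisLinear_cuspOrbit hk hke).comp i hinj using 2 with f
  rw [hi f]; rfl

theorem apply_zero_of_mem_orbitIndicators {N : ℕ} [NeZero N] {f : ZVec N → ℂ}
    (hf : f ∈ orbitIndicators N) (hne : f ≠ indicatorFun {0}) : f 0 = 0 := by
  obtain ⟨d, hd, u, rfl⟩ := hf
  obtain ⟨v, -, hv⟩ := cuspOrbit_eq_rowOrbit hd u
  rw [hv] at hne ⊢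
  refine Set.indicator_of_notMem (fun h => hne ?_) _
  rw [eq_singleton_of_zero_mem_rowOrbit h]

theorem orbitIndicators_subset_invariantFunctions {N : ℕ} [NeZero N] {f : ZVec N → ℂ}
    (hf : f ∈ orbitIndicators N) : f ∈ invariantFunctions N (CongruenceSubgroup.Gamma0 N) := by
  obtain ⟨d, hd, u, rfl⟩ := hf
  obtain ⟨v, -, hv⟩ := cuspOrbit_eq_rowOrbit hd u
  rw [hv]
  exact indicatorFun_rowOrbit_mem v

theorem eisLinear_mem_span_basisFunctions {N k : ℕ} [NeZero N] (hk : 2 ≤ k) {f : ZVec N → ℂ}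
    (hf : f ∈ hypSubspace k (invariantFunctions N (CongruenceSubgroup.Gamma0 N))) :
    eisLinear hk f ∈
      Submodule.span ℂ (Set.range fun f : basisFunctions N k => eisMap k (f : ZVec N → ℂ)) := by
  by_cases h2 : k = 2
  · let δ : ZVec N → ℂ := indicatorFun {0}
    have hδ : δ 0 = 1 := Set.indicator_of_mem (Set.mem_singleton (0 : ZVec N)) _
    -- Evaluation at 0 is unchanged by v ↦ pv, so the correction term respects the distribution
    -- relations exactly when p^k = p².
    let L : (ZVec N → ℂ) →ₗ[ℂ] (ℍ → ℂ) :=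
      eisLinear hk - (LinearMap.proj (R := ℂ) (φ := fun _ : ZVec N => ℂ) 0).smulRight
        (eisLinear hk δ)
    have hLapp : ∀ g, L g = eisLinear hk g - g 0 • eisLinear hk δ := fun g => rfl
    have hL : SatisfiesDistribution k L := by
      intro p hp hpN g hg
      rw [hLapp, hLapp, smul_sub, smul_sub, satisfiesDistribution_eisLinear hk p hp hpN g hg,
        smul_zero, congrArg ((p : ℂ) ^ ·) h2]
    have hLf := map_mem_of_orbitIndicators hL (S := Submodule.span ℂ
      (Set.range fun f : basisFunctions N k => eisMap k (f : ZVec N → ℂ))) ?_ hf.1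
    · rwa [hLapp, hf.2 h2, zero_smul, sub_zero] at hLf
    · intro g hg
      by_cases hne : g = δ
      · rw [hLapp, hne, hδ, one_smul, sub_self]
        exact Submodule.zero_mem _
      · rw [hLapp, apply_zero_of_mem_orbitIndicators hg hne, zero_smul, sub_zero]
        exact Submodule.subset_span ⟨⟨g, hg, fun _ => hne⟩, rfl⟩
  · refine map_mem_of_orbitIndicators (satisfiesDistribution_eisLinear hk) (fun g hg => ?_) hf.1
    exact Submodule.subset_span ⟨⟨g, hg, fun h => absurd h h2⟩, rfl⟩

theorem mainTheorem7 (N k : ℕ) [NeZero N] (hk : 2 ≤ k) (hk_even : Even k) :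
    -- each `[N / g, (N/d) / g, u]` is a single orbit under `Γ₀(N)`
    (∀ d : ℕ, d ∣ N → ∀ u : (ZMod (Nat.gcd d (N / d)))ˣ,
      ∃ v : ZVec N, cuspOrbit N d u = rowOrbit (CongruenceSubgroup.Gamma0 N) v) ∧
    -- the images of the indicator functions are a basis of the Eisenstein space
    LinearIndependent ℂ (fun f : basisFunctions N k => eisMap k (f : ZVec N → ℂ)) ∧
    (Submodule.span ℂ (Set.range fun f : basisFunctions N k => eisMap k (f : ZVec N → ℂ)) :
      Set (ℍ → ℂ)) = eisensteinSpace N k (CongruenceSubgroup.Gamma0 N) := by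
  refine ⟨fun d hd u => ?_, linearIndependent_eisMap_basisFunctions hk hk_even, ?_⟩
  · obtain ⟨v, -, hv⟩ := cuspOrbit_eq_rowOrbit hd u
    exact ⟨v, hv⟩
  · refine Set.Subset.antisymm ?_ ?_
    · have hle : Submodule.span ℂ
          (Set.range fun f : basisFunctions N k => eisMap k (f : ZVec N → ℂ)) ≤
          (hypSubspace k (invariantFunctions N (CongruenceSubgroup.Gamma0 N))).map
            (eisLinear hk) := by
        rw [Submodule.span_le]
        rintro _ ⟨⟨f, hf, hne⟩, rfl⟩
        exact ⟨f, ⟨orbitIndicators_subset_invariantFunctions hf,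
          fun h => apply_zero_of_mem_orbitIndicators hf (hne h)⟩, rfl⟩
      exact hle
    · rintro _ ⟨f, hf, rfl⟩
      exact eisLinear_mem_span_basisFunctions hk hf
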